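/- A one-parameter product system is a family $E=\{E_t\}_{t>0}$ of separable complex Hilbert spaces together with bilinear associative multiplications $E_s\times E_t\to E_{s+t}$, $(x,y)\mapsto xy$, such that $\langle xy|x'y'\rangle=\langle x|x'\rangle\langle y|y'\rangle$ and the products $xy$ span a dense subspace of $E_{s+t}$, and with a $\sigma$-algebra on the total space $\{(t,\xi):t>0,\ \xi\in E_t\}$ such that the multiplication is measurable and the total space is isomorphic to a trivial family $(0,\infty)\times H$, $H$ a Hilbert space, by a Borel isomorphism that preserves $t$ and is unitary on every fibre. (Inner products are linear in the first variable.) For $t>0$, let $D(t)$ be the set of decomposable vectors, that is, of the nonzero $x\in E_t$ such that for every $0<s<t$ there are $y\in E_s$ and $z\in E_{t-s}$ with $x=yz$. Let $\Delta(t)$ be the quotient of $D(t)$ by the relation $x\sim y\iff x=\lambda y$ for some $\lambda\in\mathbb{C}\setminus\{0\}$, and write $\dot x$ for the class of $x$. A (left) coherent decomposable section is a family $(x_t)_{t>0}$ with $x_t\in D(t)$ such that for all $0<r<s$ there is $x(r,s)\in E_{s-r}$ with $x_s=x_r\,x(r,s)$. Theorem. Let $e=(e_t)_{t>0}$ be a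 coherent decomposable section of $E$ with $\|e_t\|=1$ for all $t>0$. Then there is a unique function $L^e$ (the $e$-logarithm), assigning a complex number $L^e(t;\dot x,\dot y)$ to every $t>0$ and $\dot x,\dot y\in\Delta(t)$, such that for all coherent decomposable sections $(x_t)$ and $(y_t)$ the function $t\mapsto L^e(t;\dot x_t,\dot y_t)$ is continuous on $(0,\infty)$ and tends to $0$ as $t\to0^+$, and such that $$e^{L^e(t;\dot x,\dot y)}=\frac{\langle x|y\rangle}{\langle x|e_t\rangle\,\langle e_t|y\rangle}\qquad\text{for all } t>0,\ x,y\in D(t).$$ Moreover, for every $t>0$ the map $(x,y)\mapsto L^e(t;\dot x,\dot y)$ is a positive definite kernel on $D(t)$: for all $n$, $x_1,\dots,x_n\in D(t)$ and $c_1,\dots,c_n\in\mathbb{C}$, the sum $\sum_{i,j}c_i\overline{c_j}\,L^e(t;\dot x_i,\dot x_j)$ is real and nonnegative. -/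

import Mathlib

open Topology Filter
open scoped ComplexOrder

universe u

/-- The index set `(0, ∞)` of a one-parameter product system, an additive semigroup. -/
abbrev PosTime : Type := {t : ℝ // 0 < t}

/-- The total space `{(t, ξ) : t > 0, ξ ∈ E t}` of a family of spaces over `(0, ∞)`. -/
structure TotalSpace (E : PosTime → Type u) : Type u where
  time : PosTime
  vec : E time

/-- A one-parameter (Arveson) product system: a family `E t`, `t > 0`, of separable complex
Hilbert spaces whose total space carries a Borel structure and an associative multiplication
such that `x ⊗ y ↦ x y` extends to a unitary `E s ⊗ E t → E (s + t)`, such that the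
multiplication is Borel measurable, and such that the total space is isomorphic to the trivial
family `(0, ∞) × H` by a Borel isomorphism that is unitary on every fibre. (The last condition
makes the total space a standard Borel space on which the projection to `(0, ∞)`, the fibrewise
linear operations and the fibrewise inner product are measurable.) -/
structure ProductSystem (E : PosTime → Type u) [∀ t, NormedAddCommGroup (E t)]
    [∀ t, InnerProductSpace ℂ (E t)] [∀ t, CompleteSpace (E t)]
    [∀ t, TopologicalSpace.SeparableSpace (E t)] [MeasurableSpace (TotalSpace E)] where
  /-- The multiplication `E s × E t → E (s + t)`. -/
  mul : ∀ {s t : PosTime}, E s →ₗ[ℂ] E t →ₗ[ℂ] E (s + t)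
  inner_mul_mul : ∀ {s t : PosTime} (x x' : E s) (y y' : E t),
    inner ℂ (mul x y) (mul x' y') = inner ℂ x x' * inner ℂ y y'
  dense_span_mul : ∀ s t : PosTime,
    Dense (Submodule.span ℂ {z : E (s + t) | ∃ (x : E s) (y : E t), mul x y = z} :
      Set (E (s + t)))
  mul_assoc : ∀ {r s t : PosTime} (x : E r) (y : E s) (z : E t),
    TotalSpace.mk (E := E) (r + s + t) (mul (mul x y) z) =
      TotalSpace.mk (E := E) (r + (s + t)) (mul x (mul y z))
  measurable_mul : Measurable fun p : TotalSpace E × TotalSpace E =>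
    TotalSpace.mk (E := E) (p.1.time + p.2.time) (mul p.1.vec p.2.vec)
  /-- The σ-algebra of the total space is the one transported from `(0, ∞) × H` by a fibrewise
  unitary bijection. -/
  exists_trivialization : ∃ (H : Type u) (_ : NormedAddCommGroup H)
    (_ : InnerProductSpace ℂ H) (φ : ∀ t : PosTime, E t ≃ₗᵢ[ℂ] H),
    (inferInstance : MeasurableSpace (TotalSpace E)) =
      MeasurableSpace.comap (fun p : TotalSpace E => (p.time, φ p.time p.vec))
        (MeasurableSpace.prod (inferInstance : MeasurableSpace PosTime) (borel H))

namespace ProductSystem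

variable {E : PosTime → Type u} [∀ t, NormedAddCommGroup (E t)]
  [∀ t, InnerProductSpace ℂ (E t)] [∀ t, CompleteSpace (E t)]
  [∀ t, TopologicalSpace.SeparableSpace (E t)] [MeasurableSpace (TotalSpace E)]

/-- The set `D(t)` of decomposable vectors: the nonzero `x ∈ E t` such that for every
`0 < s < t` there are `y ∈ E s` and `z ∈ E (t - s)` with `x = y z`.
Here `t - s` is written as `d` with `s + d = t`. -/
def D (P : ProductSystem E) (t : PosTime) : Set (E t) :=
  {x | x ≠ 0 ∧ ∀ s d : PosTime, s + d = t → ∃ (y : E s) (z : E d),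
    TotalSpace.mk (E := E) (s + d) (P.mul y z) = TotalSpace.mk t x}

/-- A left coherent decomposable section: decomposable vectors `x_t ∈ D(t)`, `t > 0`, such that
for all `0 < r < s` there is `x(r, s) ∈ E (s - r)` with `x_s = x_r x(r, s)`.
Here `s` is written as `r + d`. -/
structure CoherentSection (P : ProductSystem E) where
  vec : ∀ t : PosTime, E t
  mem_D : ∀ t, vec t ∈ P.D t
  coherent : ∀ r d : PosTime, ∃ z : E d, vec (r + d) = P.mul (vec r) z

/-- The relation `x ∼ y` on `D(t)`: `x = c y` for some nonzero complex number `c`. -/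
instance setoidD (P : ProductSystem E) (t : PosTime) : Setoid (P.D t) where
  r x y := ∃ c : ℂ, c ≠ 0 ∧ (x : E t) = c • (y : E t)
  iseqv :=
    { refl := fun x => ⟨1, one_ne_zero, by simp⟩
      symm := by
        rintro x y ⟨c, hc, h⟩
        exact ⟨c⁻¹, inv_ne_zero hc, by rw [h, smul_smul, inv_mul_cancel₀ hc, one_smul]⟩
      trans := by
        rintro x y z ⟨c, hc, h⟩ ⟨c', hc', h'⟩
        exact ⟨c * c', mul_ne_zero hc hc', by rw [h, h', smul_smul]⟩ }

/-- The set `Δ(t)` of equivalence classes of `D(t)`. -/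
def Δ (P : ProductSystem E) (t : PosTime) : Type u := Quotient (P.setoidD t)

/-- The class `ẋ ∈ Δ(t)` of `x ∈ D(t)`. -/
def cls (P : ProductSystem E) {t : PosTime} (x : P.D t) : P.Δ t := Quotient.mk (P.setoidD t) x

/-- The class in `Δ(t)` of the value at `t` of a coherent section. -/
def CoherentSection.cls {P : ProductSystem E} (x : P.CoherentSection) (t : PosTime) : P.Δ t :=
  P.cls ⟨x.vec t, x.mem_D t⟩

/-- `f`, a function of `t > 0` and of two points of `Δ(t)`, is continuous along all pairs of
coherent sections. -/
def IsContinuous (P : ProductSystem E) (f : ∀ t : PosTime, P.Δ t → P.Δ t → ℂ) : Prop :=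
  ∀ x y : P.CoherentSection, Continuous fun t : PosTime => f t (x.cls t) (y.cls t)

/-- `f` vanishes at zero: `f (t; x_t, y_t) → 0` as `t → 0+`, for all coherent sections. -/
def VanishesAtZero (P : ProductSystem E) (f : ∀ t : PosTime, P.Δ t → P.Δ t → ℂ) : Prop :=
  ∀ x y : P.CoherentSection, Tendsto (fun t : PosTime => f t (x.cls t) (y.cls t))
    (comap (fun t : PosTime => (t : ℝ)) (𝓝[>] 0)) (𝓝 0)

/-- `L` is an `e`-logarithm: continuous, vanishing at zero, and
`exp (L (t; ẋ, ẏ)) = ⟨x|y⟩ / (⟨x|e_t⟩ ⟨e_t|y⟩)` for all `t > 0` and `x, y ∈ D(t)`.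
The inner product `⟨x|y⟩`, linear in `x`, is Mathlib's `inner ℂ y x`. -/
structure IsELogarithm (P : ProductSystem E) (e : P.CoherentSection)
    (L : ∀ t : PosTime, P.Δ t → P.Δ t → ℂ) : Prop where
  continuous : P.IsContinuous L
  vanishes : P.VanishesAtZero L
  exp_eq : ∀ (t : PosTime) (x y : P.D t), Complex.exp (L t (P.cls x) (P.cls y)) =
    inner ℂ (y : E t) (x : E t) / (inner ℂ (e.vec t) (x : E t) * inner ℂ (y : E t) (e.vec t))

end ProductSystem

/-! The core fact is that the germ of a unit coherent family e at 0 is trivial: the subspaces e_r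
E_{T-r} increase as r decreases to 0, and their union is dense in E_T
(`eq_zero_of_orthogonal_germ`). This comes from separability, by comparing uncountably many cut
points of (0, T). Hence two coherent families become parallel as t → 0. Applied to tails, and in the
opposite family to right ends, this yields that coherent families are never orthogonal
(`inner_vec_ne_zero`) and that the kernel k_t(x, y) = ⟨x_t|y_t⟩ / (⟨x_t|e_t⟩⟨e_t|y_t⟩) is continuous
with limit 1 at 0. It therefore has a unique continuous logarithm starting at 0.

For positivity, k_t = k_s (1 + ⟨a_x|a_y⟩) for s ≤ t (`exists_ratio_eq`). Over a short step the
logarithm grows by a Gram kernel plus a quadratic error, which a small multiple of the diagonal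
increments absorbs. Continuous induction, followed by letting that multiple tend to 0, gives
`sum_logRatio_nonneg`.

Every decomposable vector lies on a coherent section whose earlier values are determined up to
scalars, so the logarithm descends to Δ(t). -/

theorem PosTime.exists_add_eq {s t : PosTime} (h : s < t) : ∃ d : PosTime, s + d = t :=
  ⟨⟨t - s, sub_pos.2 h⟩, Subtype.ext (by simp)⟩

theorem PosTime.left_lt_add (s d : PosTime) : s < s + d := by
  have := d.2
  exact Subtype.coe_lt_coe.1 (by simpa using this)

theorem PosTime.left_lt {s d t : PosTime} (h : s + d = t) : s < t := h ▸ PosTime.left_lt_add s d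

theorem PosTime.right_lt {s d t : PosTime} (h : s + d = t) : d < t :=
  PosTime.left_lt ((add_comm d s).trans h)

/-! ### Factorization and projections in a tensor family. -/

/-- The algebraic part of a product system, with the multiplication `E s × E t → E u` indexed by
a proof of `s + t = u`. -/
structure TensorFamily (E : PosTime → Type u) [∀ t, NormedAddCommGroup (E t)]
    [∀ t, InnerProductSpace ℂ (E t)] where
  mul : ∀ {s t u : PosTime}, s + t = u → E s →ₗ[ℂ] E t →ₗ[ℂ] E u
  inner_mul_mul : ∀ {s t u : PosTime} (h : s + t = u) (x x' : E s) (y y' : E t),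
    inner ℂ (mul h x y) (mul h x' y') = inner ℂ x x' * inner ℂ y y'
  dense_span_mul : ∀ {s t u : PosTime} (h : s + t = u),
    Dense (Submodule.span ℂ {z : E u | ∃ (x : E s) (y : E t), mul h x y = z} : Set (E u))
  mul_assoc : ∀ {r s t rs st u : PosTime} (h₁ : r + s = rs) (h₂ : rs + t = u) (h₃ : s + t = st)
    (h₄ : r + st = u) (x : E r) (y : E s) (z : E t),
    mul h₂ (mul h₁ x y) z = mul h₄ x (mul h₃ y z)

namespace TensorFamily

variable {E : PosTime → Type u} [∀ t, NormedAddCommGroup (E t)] [∀ t, InnerProductSpace ℂ (E t)]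

/-- The opposite family, in which the order of the factors is reversed. -/
def op (M : TensorFamily E) : TensorFamily E where
  mul {s t _} h := (M.mul ((add_comm t s).trans h)).flip
  inner_mul_mul h x x' y y' := by
    simp only [LinearMap.flip_apply, M.inner_mul_mul, mul_comm]
  dense_span_mul {s t _} h := by
    have := M.dense_span_mul ((add_comm t s).trans h)
    simp only [LinearMap.flip_apply]
    convert this using 4
    exact funext fun _ => propext exists_comm
  mul_assoc _ _ _ _ x y z := (M.mul_assoc _ _ _ _ z y x).symm

theorem op_mul (M : TensorFamily E) {s t u : PosTime} (h : s + t = u) (h' : t + s = u) (x : E s)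
    (y : E t) : M.op.mul h x y = M.mul h' y x := rfl

variable (M : TensorFamily E) {r s t u d : PosTime}

theorem norm_mul (h : s + t = u) (x : E s) (y : E t) : ‖M.mul h x y‖ = ‖x‖ * ‖y‖ := by
  have h1 := M.inner_mul_mul h x x y y
  simp only [inner_self_eq_norm_sq_to_K] at h1
  have h2 : ‖M.mul h x y‖ ^ 2 = (‖x‖ * ‖y‖) ^ 2 := by
    rw [mul_pow]; exact_mod_cast h1
  exact (sq_eq_sq₀ (norm_nonneg _) (by positivity)).1 h2

theorem mul_ne_zero (h : s + t = u) {x : E s} {y : E t} (hx : x ≠ 0) (hy : y ≠ 0) :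
    M.mul h x y ≠ 0 := by
  rw [← norm_ne_zero_iff, norm_mul]
  exact _root_.mul_ne_zero (norm_ne_zero_iff.2 hx) (norm_ne_zero_iff.2 hy)

theorem right_ne_zero {h : s + t = u} {x : E s} {y : E t} (hz : M.mul h x y ≠ 0) : y ≠ 0 := by
  rintro rfl; simp at hz

theorem left_ne_zero {h : s + t = u} {x : E s} {y : E t} (hz : M.mul h x y ≠ 0) : x ≠ 0 := by
  rintro rfl; simp at hz

theorem mul_left_cancel (h : s + t = u) {x : E s} (hx : x ≠ 0) {y y' : E t}
    (hy : M.mul h x y = M.mul h x y') : y = y' := by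
  have h1 : M.mul h x (y - y') = 0 := by rw [map_sub, hy, sub_self]
  by_contra hne
  exact M.mul_ne_zero h hx (sub_ne_zero.2 hne) h1

/-- In two factorizations of a nonzero vector the left factors are proportional. -/
theorem exists_smul_of_mul_eq (h : s + t = u) {x x' : E s} {y y' : E t}
    (hxy : M.mul h x y = M.mul h x' y') (hne : M.mul h x y ≠ 0) : ∃ c : ℂ, c ≠ 0 ∧ x = c • x' := by
  have hy := M.right_ne_zero hne
  have hx := M.left_ne_zero hne
  have hn : inner ℂ y y ≠ 0 := inner_self_ne_zero.2 hy
  -- Pairing both factorizations with w y, for arbitrary w, strips off the right factors.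
  have key : x = (inner ℂ y y' / inner ℂ y y) • x' := by
    refine ext_inner_left ℂ fun w => ?_
    have h1 : inner ℂ (M.mul h w y) (M.mul h x y) = inner ℂ (M.mul h w y) (M.mul h x' y') := by
      rw [hxy]
    rw [M.inner_mul_mul, M.inner_mul_mul] at h1
    rw [inner_smul_right]
    field_simp
    rw [h1]; ring
  refine ⟨_, fun hc => hx ?_, key⟩
  rw [key, hc, zero_smul]

/-- A vector orthogonal to all products vanishes. -/
theorem eq_zero_of_inner_mul_eq_zero (h : s + t = u) {z : E u}
    (hz : ∀ x y, inner ℂ (M.mul h x y) z = 0) : z = 0 := by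
  have h1 : z ∈ (Submodule.span ℂ {z : E u | ∃ (x : E s) (y : E t), M.mul h x y = z})ᗮ := by
    rw [Submodule.mem_orthogonal]
    intro v hv
    induction hv using Submodule.span_induction with
    | mem v hv => obtain ⟨x, y, rfl⟩ := hv; exact hz x y
    | zero => simp
    | add v w _ _ hv hw => rw [inner_add_left, hv, hw, add_zero]
    | smul c v _ hv => rw [inner_smul_left, hv, mul_zero]
  exact (M.dense_span_mul h).eq_zero_of_mem_orthogonal h1

variable [∀ t, CompleteSpace (E t)]

/-- The orthogonal projection onto `y E t` exists. -/
theorem exists_inner_mul_sub_eq_zero (h : s + t = u) (y : E s) (x : E u) :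
    ∃ w : E t, ∀ v, inner ℂ (M.mul h y v) (x - M.mul h y w) = 0 := by
  rcases eq_or_ne y 0 with rfl | hy
  · exact ⟨0, by simp⟩
  let T : E t →L[ℂ] E u := (M.mul h y).mkContinuous ‖y‖ fun v => (M.norm_mul h y v).le
  have hn : inner ℂ y y ≠ 0 := inner_self_ne_zero.2 hy
  -- T is ‖y‖ times an isometry, so T*T = ‖y‖² and the coefficient of the projection is T*x / ‖y‖².
  refine ⟨(inner ℂ y y)⁻¹ • ContinuousLinearMap.adjoint T x, fun v => ?_⟩
  rw [inner_sub_right, M.inner_mul_mul, inner_smul_right, ContinuousLinearMap.adjoint_inner_right,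
    mul_inv_cancel_left₀ hn]
  exact sub_self _

/-- If `x z = y w` with `y` over a shorter interval than `x`, then `y` divides `x` on the left. -/
theorem exists_eq_mul_of_mul_eq {s' t' : PosTime} (h : s + t = u) (h' : s' + t' = u)
    (hd : s' + d = s) {x : E s} {z : E t} {y : E s'} {w : E t'}
    (hxy : M.mul h x z = M.mul h' y w) (hz : z ≠ 0) : ∃ v : E d, x = M.mul hd y v := by
  obtain ⟨v, hv⟩ := M.exists_inner_mul_sub_eq_zero hd y x
  refine ⟨v, ?_⟩
  set q := x - M.mul hd y v with hq
  have hdt : d + t = t' := by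
    apply add_left_cancel (a := s')
    rw [← add_assoc, hd, h, h']
  -- Since q is orthogonal to y E_d, the coefficient w₀ of the projection of q z onto y E_{t'} is
  -- orthogonal to every product a b, and these are total in E_{t'}. So q z is orthogonal to y w = x
  -- z, which forces q to be orthogonal to x.
  have h1 : ∀ w', inner ℂ (M.mul h' y w') (M.mul h q z) = 0 := by
    obtain ⟨w₀, hw₀⟩ := M.exists_inner_mul_sub_eq_zero h' y (M.mul h q z)
    intro w'
    have h2 : inner ℂ y y • w₀ = 0 := by
      refine M.eq_zero_of_inner_mul_eq_zero hdt fun a b => ?_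
      have h3 := hw₀ (M.mul hdt a b)
      rw [inner_sub_right, ← M.mul_assoc hd h hdt h', M.inner_mul_mul, hv, zero_mul, zero_sub,
        neg_eq_zero, M.mul_assoc hd h hdt h', M.inner_mul_mul] at h3
      rw [inner_smul_right, h3]
    have h4 := hw₀ w'
    rw [inner_sub_right, M.inner_mul_mul, ← inner_smul_right, h2, inner_zero_right, sub_zero] at h4
    exact h4
  have h5 : inner ℂ (M.mul h x z) (M.mul h q z) = 0 := by rw [hxy]; exact h1 w
  rw [M.inner_mul_mul, mul_eq_zero, or_iff_left (inner_self_ne_zero.2 hz)] at h5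
  have h6 : inner ℂ q q = 0 := by
    conv_lhs => rw [hq, inner_sub_left, ← hq, h5, hv, sub_zero]
  exact sub_eq_zero.1 (inner_self_eq_zero.1 h6)

end TensorFamily

/-! ### Triviality of the germ at 0 and asymptotic parallelism. -/

/-- An uncountable family in a separable metric space contains two members at small distance. -/
theorem exists_ne_dist_lt {ι X : Type*} [Uncountable ι] [PseudoMetricSpace X]
    [TopologicalSpace.SeparableSpace X] (f : ι → X) {ε : ℝ} (hε : 0 < ε) :
    ∃ i j, i ≠ j ∧ dist (f i) (f j) < ε := by
  have : Nonempty X := ⟨f (Classical.arbitrary ι)⟩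
  choose n hn using fun i =>
    (TopologicalSpace.denseRange_denseSeq X).exists_dist_lt (f i) (half_pos hε)
  have : ¬ Function.Injective n := fun h => (not_countable (α := ι)) h.countable
  simp only [Function.Injective, not_forall] at this
  obtain ⟨i, j, hij, hne⟩ := this
  refine ⟨i, j, hne, ?_⟩
  have h1 := hn i
  have h2 := hn j
  rw [← hij] at h2
  linarith [dist_triangle_right (f i) (f j) (TopologicalSpace.denseSeq X (n i))]

theorem inner_sub_inner_smul_self {F : Type*} [NormedAddCommGroup F] [InnerProductSpace ℂ F]
    (x : F) {e : F} (he : ‖e‖ = 1) : inner ℂ (x - (inner ℂ e x : ℂ) • e) e = 0 := by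
  rw [inner_sub_left, inner_smul_left, inner_conj_symm, inner_self_eq_norm_sq_to_K, he]
  simp

namespace TensorFamily

variable {E : PosTime → Type u} [∀ t, NormedAddCommGroup (E t)] [∀ t, InnerProductSpace ℂ (E t)]

/-- Left coherence of a family of vectors on `(0, T]`. -/
def CoherentUpTo (M : TensorFamily E) (T : PosTime) (e : ∀ t, E t) : Prop :=
  ∀ ⦃r d s : PosTime⦄ (h : r + d = s), s ≤ T → ∃ z, e s = M.mul h (e r) z

variable {M : TensorFamily E} {T : PosTime} {e : ∀ t, E t}

/-- If `b` spoils the density of the germ subspaces `e r E (T - r)` in `E T`, then their density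
fails in every `E s`, `s < T`. -/
theorem exists_unit_orthogonal [∀ t, CompleteSpace (E t)] {b : E T} (hb : b ≠ 0)
    (horth : ∀ r d (h : r + d = T) (w : E d), inner ℂ (M.mul h (e r) w) b = 0)
    {s : PosTime} (hs : s < T) :
    ∃ v : E s, ‖v‖ = 1 ∧ ∀ r d (h : r + d = s) (w : E d), inner ℂ (M.mul h (e r) w) v = 0 := by
  suffices ∃ v : E s, v ≠ 0 ∧ ∀ r d (h : r + d = s) (w : E d),
      inner ℂ (M.mul h (e r) w) v = 0 by
    obtain ⟨v, hv, hv'⟩ := this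
    refine ⟨((‖v‖⁻¹ : ℝ) : ℂ) • v, ?_, fun r d h w => ?_⟩
    · rw [norm_smul, Complex.norm_real, norm_inv, norm_norm,
        inv_mul_cancel₀ (norm_ne_zero_iff.2 hv)]
    · rw [inner_smul_right, hv', mul_zero]
  by_contra! hcon
  obtain ⟨c, hc⟩ := PosTime.exists_add_eq hs
  have hc' : c + s = T := (add_comm c s).trans hc
  refine hb (M.eq_zero_of_inner_mul_eq_zero hc fun x y => ?_)
  -- Compress b to E_s along y: v y is the projection of b onto E_s y. As b is orthogonal to each
  -- e_r (w y), v is orthogonal to each e_r w, so v = 0 and b is orthogonal to E_s y.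
  obtain ⟨v, hv⟩ := M.op.exists_inner_mul_sub_eq_zero hc' y b
  have hop : ∀ x, M.op.mul hc' y x = M.mul hc x y := fun x => rfl
  simp only [hop] at hv
  rcases eq_or_ne y 0 with rfl | hy
  · simp
  have hv0 : v = 0 := by
    by_contra hne
    obtain ⟨r, d, h, w, hw⟩ := hcon v hne
    apply hw
    have hdc : r + (d + c) = T := by rw [← add_assoc, h, hc]
    have h1 := hv (M.mul h (e r) w)
    rw [inner_sub_right, M.inner_mul_mul, M.mul_assoc h hc rfl hdc, horth, zero_sub,
      neg_eq_zero, _root_.mul_eq_zero, or_iff_left (inner_self_ne_zero.2 hy)] at h1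
    exact h1
  have h2 := hv x
  rwa [hv0, map_zero, LinearMap.zero_apply, sub_zero] at h2

/-- The germ of a coherent family at `0` is trivial: the subspaces `e r E (T - r)`, `r → 0`,
exhaust `E T`. -/
theorem eq_zero_of_orthogonal_germ [∀ t, CompleteSpace (E t)]
    [∀ t, TopologicalSpace.SeparableSpace (E t)] (he : M.CoherentUpTo T e)
    (hn : ∀ t ≤ T, ‖e t‖ = 1) {b : E T}
    (horth : ∀ r d (h : r + d = T) (w : E d), inner ℂ (M.mul h (e r) w) b = 0) : b = 0 := by
  by_contra hb
  choose! b hb1 hb using fun s (hs : s < T) => exists_unit_orthogonal hb horth hs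
  have hd : ∀ s : Set.Iio T, ∃ d, s.1 + d = T := fun s => PosTime.exists_add_eq s.2
  choose d hd using hd
  have hdT : ∀ s, d s < T := fun s => PosTime.right_lt (hd s)
  have : Uncountable (Set.Iio T) := by
    have hinj : Function.Injective fun x : Set.Ioo (0 : ℝ) T =>
        (⟨⟨x.1, x.2.1⟩, x.2.2⟩ : Set.Iio T) := by
      intro x y hxy
      simpa [Subtype.ext_iff] using hxy
    have : Uncountable (Set.Ioo (0 : ℝ) T) := by
      rw [← Cardinal.aleph0_lt_mk_iff, Cardinal.mk_Ioo_real T.2]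
      exact Cardinal.aleph0_lt_continuum
    exact hinj.uncountable
  -- For each cut s of T, record e_s e_{T-s} and e_s b_{T-s}. Uncountably many pairs cannot be
  -- separated by 1/4; this constant makes the two bounds below add up to less than 1.
  obtain ⟨s, s', hne, hdist⟩ : ∃ s s' : Set.Iio T, s' < s ∧
      dist (M.mul (hd s) (e s) (e (d s)), M.mul (hd s) (e s) (b (d s)))
        (M.mul (hd s') (e s') (e (d s')), M.mul (hd s') (e s') (b (d s'))) < 1 / 4 := by
    obtain ⟨s, s', hne, hlt⟩ := exists_ne_dist_lt (fun s : Set.Iio T =>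
      (M.mul (hd s) (e s) (e (d s)), M.mul (hd s) (e s) (b (d s)))) (ε := 1 / 4) (by norm_num)
    rcases lt_or_gt_of_ne hne with h | h
    · exact ⟨s', s, h, by rwa [dist_comm]⟩
    · exact ⟨s, s', h, hlt⟩
  rw [Prod.dist_eq, max_lt_iff] at hdist
  simp only [dist_eq_norm] at hdist
  obtain ⟨hA, hB⟩ := hdist
  obtain ⟨r, hr⟩ := PosTime.exists_add_eq (show (s' : PosTime) < s from hne)
  have hrd : r + d s = d s' := by
    apply add_left_cancel (a := (s' : PosTime))
    rw [← add_assoc, hr, hd, hd]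
  -- Split e_s into its projection p onto E_{s'} e_r and the remainder.
  obtain ⟨y, hy⟩ := M.op.exists_inner_mul_sub_eq_zero ((add_comm _ _).trans hr) (e r) (e s)
  change ∀ v, inner ℂ (M.mul hr v (e r)) (e s - M.mul hr y (e r)) = 0 at hy
  set p := M.mul hr y (e r) with hp
  have hes : ‖e s‖ = 1 := hn _ s.2.le
  have hed : ‖e (d s)‖ = 1 := hn _ (hdT s).le
  -- the component along `E s' (e r)` is small
  have hpe : inner ℂ p (e s) = inner ℂ p p := by
    have := hy y
    rwa [inner_sub_right, sub_eq_zero] at this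
  have hp1 : ‖p‖ ≤ 1 / 4 := by
    -- Reassociated, p b_{d s} = y (e_r b_{d s}), which is orthogonal to e_{s'} b_{d s'} by the
    -- choice of b_{d s'}.
    have h1 : inner ℂ (M.mul (hd s) p (b (d s)))
        (M.mul (hd s) (e s) (b (d s)) - M.mul (hd s') (e s') (b (d s'))) = inner ℂ p p := by
      rw [inner_sub_right, M.inner_mul_mul, hp, M.mul_assoc hr (hd s) hrd (hd s'),
        M.inner_mul_mul, hb _ (hdT s'), mul_zero, sub_zero, ← hp, hpe,
        inner_self_eq_norm_sq_to_K (b (d s)), hb1 _ (hdT s)]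
      simp
    have h2 : ‖p‖ * ‖p‖ ≤ ‖p‖ * (1 / 4) := by
      calc ‖p‖ * ‖p‖ = ‖inner ℂ p p‖ := by
            rw [inner_self_eq_norm_sq_to_K, norm_pow, sq]; simp
        _ ≤ ‖M.mul (hd s) p (b (d s))‖ * _ := h1 ▸ norm_inner_le_norm _ _
        _ ≤ ‖p‖ * (1 / 4) := by
            rw [M.norm_mul, hb1 _ (hdT s), mul_one]
            gcongr
    by_contra! hlt
    exact absurd h2 (not_le.2 (by gcongr))
  have hqe : inner ℂ (e s - p) (e s) = inner ℂ (e s - p) (e s - p) := by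
    rw [inner_sub_right (e s - p), ← inner_conj_symm (e s - p) p, hp, hy, map_zero, sub_zero]
  have hq1 : ‖e s - p‖ ≤ 1 / 4 := by
    -- Now coherence of e is used: e_{s'} e_{d s'} = (e_{s'} e_r) w, and e_s - p is orthogonal to
    -- E_{s'} e_r.
    obtain ⟨w, hw⟩ := he hrd (hdT s').le
    have h1 : inner ℂ (M.mul (hd s) (e s - p) (e (d s)))
        (M.mul (hd s) (e s) (e (d s)) - M.mul (hd s') (e s') (e (d s'))) =
          inner ℂ (e s - p) (e s - p) := by
      rw [inner_sub_right, M.inner_mul_mul, hw, ← M.mul_assoc hr (hd s) hrd (hd s'),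
        M.inner_mul_mul, ← inner_conj_symm (e s - p) (M.mul hr _ _), hy, map_zero, zero_mul,
        sub_zero, hqe, inner_self_eq_norm_sq_to_K (e (d s)), hed]
      simp
    have h2 : ‖e s - p‖ * ‖e s - p‖ ≤ ‖e s - p‖ * (1 / 4) := by
      calc ‖e s - p‖ * ‖e s - p‖ = ‖inner ℂ (e s - p) (e s - p)‖ := by
            rw [inner_self_eq_norm_sq_to_K, norm_pow, sq]; simp
        _ ≤ ‖M.mul (hd s) (e s - p) (e (d s))‖ * _ := h1 ▸ norm_inner_le_norm _ _
        _ ≤ ‖e s - p‖ * (1 / 4) := by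
            rw [M.norm_mul, hed, mul_one]
            gcongr
    by_contra! hlt
    exact absurd h2 (not_le.2 (by gcongr))
  have : ‖e s‖ ≤ ‖e s - p‖ + ‖p‖ := by simpa using norm_add_le (e s - p) p
  linarith

/-- The subspaces e_r E_{T-r} are nested because e_t divides e_r on the left. -/
theorem CoherentUpTo.exists_mul_eq (he : M.CoherentUpTo T e) {r t d : PosTime}
    (h : r + d = T) (htr : t ≤ r) (w : E d) : ∃ (c : PosTime) (h' : t + c = T) (z : E c),
      M.mul h (e r) w = M.mul h' (e t) z := by
  rcases htr.eq_or_lt with rfl | hlt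
  · exact ⟨d, h, w, rfl⟩
  · obtain ⟨a, ha⟩ := PosTime.exists_add_eq hlt
    obtain ⟨z, hz⟩ := he ha (PosTime.left_lt h).le
    exact ⟨a + d, by rw [← add_assoc, ha, h], M.mul rfl z w, by
      rw [hz]; exact M.mul_assoc _ _ _ _ _ _ _⟩

variable [∀ t, CompleteSpace (E t)] [∀ t, TopologicalSpace.SeparableSpace (E t)]

/-- A nested union of subspaces is already a subspace, so no linear combinations are needed. -/
theorem exists_norm_sub_mul_lt (he : M.CoherentUpTo T e) (hn : ∀ t ≤ T, ‖e t‖ = 1) (x : E T)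
    {ε : ℝ} (hε : 0 < ε) :
    ∃ (r d : PosTime) (h : r + d = T) (w : E d), ‖x - M.mul h (e r) w‖ < ε := by
  set S : Set (E T) := {z | ∃ (r d : PosTime) (h : r + d = T) (w : E d), M.mul h (e r) w = z}
  have hS : (Submodule.span ℂ S).topologicalClosure = ⊤ := by
    rw [Submodule.topologicalClosure_eq_top_iff, eq_bot_iff]
    intro b hb
    rw [Submodule.mem_orthogonal] at hb
    exact eq_zero_of_orthogonal_germ he hn fun r d h w =>
      hb _ (Submodule.subset_span ⟨r, d, h, w, rfl⟩)
  have hspan : ∀ z ∈ Submodule.span ℂ S, z ∈ S := by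
    intro z hz
    induction hz using Submodule.span_induction with
    | mem z hz => exact hz
    | zero =>
      have hT : (⟨T / 2, half_pos T.2⟩ : PosTime) + ⟨T / 2, half_pos T.2⟩ = T :=
        Subtype.ext (add_halves _)
      exact ⟨_, _, hT, 0, map_zero _⟩
    | add v w _ _ hv hw =>
      obtain ⟨r, d, h, v, rfl⟩ := hv
      obtain ⟨r', d', h', w, rfl⟩ := hw
      obtain ⟨c, hc, v', hv'⟩ := he.exists_mul_eq h (min_le_left r r') v
      obtain ⟨c', hc', w', hw'⟩ := he.exists_mul_eq h' (min_le_right r r') w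
      obtain rfl : c = c' := add_left_cancel (hc.trans hc'.symm)
      exact ⟨_, _, hc, v' + w', by rw [map_add, hv', hw']⟩
    | smul c v _ hv =>
      obtain ⟨r, d, h, v, rfl⟩ := hv
      exact ⟨r, d, h, c • v, map_smul _ _ _⟩
  have hx : x ∈ closure (Submodule.span ℂ S : Set (E T)) := by
    rw [← Submodule.topologicalClosure_coe, hS]; trivial
  obtain ⟨z, hz, hxz⟩ := Metric.mem_closure_iff.1 hx ε hε
  obtain ⟨r, d, h, w, rfl⟩ := hspan z hz
  exact ⟨r, d, h, w, by rwa [dist_eq_norm] at hxz⟩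

/-- A single approximation of x_T by e_r w serves all t ≤ r. Write x_T = x_t z and e_r w = e_t w',
and let q be the part of x_t orthogonal to e_t: pairing the difference with q z kills e_t w', and
‖z‖ cancels. -/
theorem exists_forall_norm_sub_le (he : M.CoherentUpTo T e) (hn : ∀ t ≤ T, ‖e t‖ = 1)
    {x : ∀ t, E t} (hx : M.CoherentUpTo T x) (hx0 : x T ≠ 0) {ε : ℝ} (hε : 0 < ε) :
    ∃ r < T, ∀ t ≤ r, ‖x t - (inner ℂ (e t) (x t) : ℂ) • e t‖ ≤ ε * ‖x t‖ := by
  obtain ⟨r, d, h, w, hw⟩ := exists_norm_sub_mul_lt he hn (x T)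
    (mul_pos hε (norm_pos_iff.2 hx0))
  have hrT := PosTime.left_lt h
  refine ⟨r, hrT, fun t ht => ?_⟩
  obtain ⟨c, hc, w', hw'⟩ := he.exists_mul_eq h ht w
  obtain ⟨z, hz⟩ := hx hc le_rfl
  have hz0 : z ≠ 0 := by rw [hz] at hx0; exact M.right_ne_zero hx0
  rw [hw', hz, M.norm_mul] at hw
  set q := x t - (inner ℂ (e t) (x t) : ℂ) • e t with hq
  have hqe : inner ℂ q (e t) = 0 := inner_sub_inner_smul_self (x t) (hn t (ht.trans hrT.le))
  have hqx : inner ℂ q (x t) = inner ℂ q q := by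
    conv_rhs => rw [hq, inner_sub_right, ← hq, inner_smul_right, hqe, mul_zero, sub_zero]
  have h1 : inner ℂ (M.mul hc q z) (M.mul hc (x t) z - M.mul hc (e t) w') =
      inner ℂ q q * inner ℂ z z := by
    rw [inner_sub_right, M.inner_mul_mul, M.inner_mul_mul, hqe, hqx, zero_mul, sub_zero]
  have h2 := norm_inner_le_norm (𝕜 := ℂ) (M.mul hc q z) (M.mul hc (x t) z - M.mul hc (e t) w')
  rw [h1, _root_.norm_mul, M.norm_mul, inner_self_eq_norm_sq_to_K, inner_self_eq_norm_sq_to_K] at h2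
  simp only [norm_pow, Complex.coe_algebraMap, Complex.norm_real, norm_norm] at h2
  have hzp : 0 < ‖z‖ := norm_pos_iff.2 hz0
  by_contra! hlt
  have hqp : 0 < ‖q‖ := lt_of_le_of_lt (by positivity) hlt
  have h3 : ‖q‖ * ‖z‖ * (‖q‖ * ‖z‖) < ‖q‖ * ‖z‖ * (ε * ‖x t‖ * ‖z‖) := by
    calc _ = ‖q‖ ^ 2 * ‖z‖ ^ 2 := by ring
      _ ≤ _ := h2
      _ < _ := by gcongr; linarith
  have h4 := lt_of_mul_lt_mul_left h3 (by positivity)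
  have h5 := lt_of_mul_lt_mul_right h4 hzp.le
  linarith

/-- Two coherent families are asymptotically parallel at `0`. -/
theorem exists_forall_norm_mul_norm_sq_le {x y : ∀ t, E t} (hx : M.CoherentUpTo T x)
    (hy : M.CoherentUpTo T y) (hx0 : ∀ t ≤ T, x t ≠ 0) (hy0 : ∀ t ≤ T, y t ≠ 0) {c : ℝ}
    (hc : 1 < c) : ∃ r < T, ∀ t ≤ r, (‖x t‖ * ‖y t‖) ^ 2 ≤ c * ‖inner ℂ (y t) (x t)‖ ^ 2 := by
  set e : ∀ t, E t := fun t => ((‖y t‖⁻¹ : ℝ) : ℂ) • y t with he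
  have hn : ∀ t ≤ T, ‖e t‖ = 1 := fun t ht => by
    rw [he, norm_smul, Complex.norm_real, norm_inv, norm_norm,
      inv_mul_cancel₀ (norm_ne_zero_iff.2 (hy0 t ht))]
  have hec : M.CoherentUpTo T e := by
    intro r d s h hs
    obtain ⟨z, hz⟩ := hy h hs
    have hr := hy0 r ((PosTime.left_lt h).le.trans hs)
    refine ⟨(((‖y s‖⁻¹ : ℝ) : ℂ) * (‖y r‖ : ℂ)) • z, ?_⟩
    have h1 : (‖y r‖ : ℂ) ≠ 0 := by exact_mod_cast norm_ne_zero_iff.2 hr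
    simp only [he, map_smul, LinearMap.smul_apply, smul_smul, ← hz]
    congr 1
    push_cast
    field_simp
  -- With ε² = 1 - 1/c, Pythagoras leaves at least ‖x_t‖² / c for the component along e_t.
  set ε : ℝ := √(1 - c⁻¹) with hε
  have hc1 : c⁻¹ < 1 := inv_lt_one_of_one_lt₀ hc
  have hεp : 0 < ε := Real.sqrt_pos.2 (by linarith)
  have hε2 : ε ^ 2 = 1 - c⁻¹ := Real.sq_sqrt (by linarith)
  obtain ⟨r, hr, H⟩ := exists_forall_norm_sub_le hec hn hx (hx0 T le_rfl) hεp
  refine ⟨r, hr, fun t ht => ?_⟩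
  have htT := ht.trans hr.le
  have h1 : ‖x t‖ ^ 2 = ‖x t - (inner ℂ (e t) (x t) : ℂ) • e t‖ ^ 2 +
      ‖inner ℂ (e t) (x t)‖ ^ 2 := by
    have h2 := norm_add_sq_eq_norm_sq_add_norm_sq_of_inner_eq_zero (𝕜 := ℂ)
      (x t - (inner ℂ (e t) (x t) : ℂ) • e t) ((inner ℂ (e t) (x t) : ℂ) • e t) (by
        rw [inner_smul_right, inner_sub_inner_smul_self _ (hn t htT), mul_zero])
    rw [sub_add_cancel, norm_smul, hn t htT, mul_one] at h2
    simpa only [sq] using h2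
  have h3 : ‖x t - (inner ℂ (e t) (x t) : ℂ) • e t‖ ^ 2 ≤ (1 - c⁻¹) * ‖x t‖ ^ 2 := by
    rw [← hε2, ← mul_pow]
    gcongr
    exact H t ht
  have h4 : ‖inner ℂ (y t) (x t)‖ = ‖y t‖ * ‖inner ℂ (e t) (x t)‖ := by
    have : ‖y t‖ ≠ 0 := norm_ne_zero_iff.2 (hy0 t htT)
    simp only [he]
    rw [inner_smul_left, _root_.norm_mul, Complex.conj_ofReal, Complex.norm_real, norm_inv, norm_norm]
    field_simp
  have h5 : ‖x t‖ ^ 2 ≤ c * ‖inner ℂ (e t) (x t)‖ ^ 2 := by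
    have h6 : c⁻¹ * ‖x t‖ ^ 2 ≤ ‖inner ℂ (e t) (x t)‖ ^ 2 := by linarith
    have hc0 : 0 < c := by linarith
    calc ‖x t‖ ^ 2 = c * (c⁻¹ * ‖x t‖ ^ 2) := by field_simp
      _ ≤ _ := by gcongr
  rw [h4, mul_pow, mul_pow]
  nlinarith [sq_nonneg ‖y t‖]

end TensorFamily

/-! ### Coherent sections, their tails and right ends. -/

theorem one_add_inner_sub {F : Type*} [NormedAddCommGroup F] [InnerProductSpace ℂ F] {e x y : F}
    (he : ‖e‖ = 1) (hx : inner ℂ e x ≠ 0) (hy : inner ℂ y e ≠ 0) :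
    1 + inner ℂ ((inner ℂ e y)⁻¹ • y - e) ((inner ℂ e x)⁻¹ • x - e) =
      inner ℂ y x / (inner ℂ e x * inner ℂ y e) := by
  simp only [inner_sub_left, inner_sub_right, inner_smul_left, inner_smul_right, map_inv₀,
    inner_conj_symm, inner_self_eq_norm_sq_to_K, he]
  field_simp
  simp

namespace TensorFamily

variable {E : PosTime → Type u} [∀ t, NormedAddCommGroup (E t)] [∀ t, InnerProductSpace ℂ (E t)]

/-- A left coherent family of nonzero vectors. -/
structure LeftSection (M : TensorFamily E) where
  vec : ∀ t, E t
  ne_zero : ∀ t, vec t ≠ 0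
  coherent : ∀ ⦃r d s : PosTime⦄ (h : r + d = s), ∃ z, vec s = M.mul h (vec r) z

namespace LeftSection

variable {M : TensorFamily E}

theorem coherentUpTo (x : LeftSection M) (T : PosTime) : M.CoherentUpTo T x.vec :=
  fun _ _ _ h _ => x.coherent h

/-- Left cancellation makes the right factors after time s coherent; behaviour just after s thus
reduces to behaviour at 0. -/
theorem exists_tail (x : LeftSection M) (s : PosTime) : ∃ y : LeftSection M,
    ∀ ⦃d t : PosTime⦄ (h : s + d = t), x.vec t = M.mul h (x.vec s) (y.vec d) := by
  choose y hy using fun d => x.coherent (rfl : s + d = s + d)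
  refine ⟨⟨y, fun d => ?_, fun a b c h => ?_⟩, fun d t h => ?_⟩
  · exact M.right_ne_zero (hy d ▸ x.ne_zero _)
  · have h' : s + a + b = s + c := by rw [add_assoc, h]
    obtain ⟨z, hz⟩ := x.coherent h'
    refine ⟨z, M.mul_left_cancel rfl (x.ne_zero s) ?_⟩
    rw [← hy, hz, hy a]
    exact M.mul_assoc _ _ _ _ _ _ _
  · subst h
    exact hy d

theorem exists_rightEnd (x : LeftSection M) (T : PosTime) : ∃ f : ∀ r, E r,
    ∀ ⦃s r : PosTime⦄ (h : s + r = T), x.vec T = M.mul h (x.vec s) (f r) := by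
  have : ∀ r : PosTime, ∃ z : E r, ∀ (s : PosTime) (h : s + r = T),
      x.vec T = M.mul h (x.vec s) z := by
    intro r
    by_cases hr : ∃ s, s + r = T
    · obtain ⟨s, h⟩ := hr
      obtain ⟨z, hz⟩ := x.coherent h
      refine ⟨z, fun s' h' => ?_⟩
      obtain rfl : s' = s := add_right_cancel (h'.trans h.symm)
      exact hz
    -- There is no right end of length r ≥ T; the value is arbitrary.
    · exact ⟨0, fun s h => absurd ⟨s, h⟩ hr⟩
  choose f hf using this
  exact ⟨f, fun s r h => hf r s h⟩

theorem rightEnd_ne_zero (x : LeftSection M) {T : PosTime} {f : ∀ r, E r}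
    (hf : ∀ ⦃s r : PosTime⦄ (h : s + r = T), x.vec T = M.mul h (x.vec s) (f r)) {r : PosTime}
    (hr : r < T) : f r ≠ 0 := by
  obtain ⟨s, hs⟩ := PosTime.exists_add_eq hr
  have h := hf ((add_comm s r).trans hs)
  exact M.right_ne_zero (h ▸ x.ne_zero T)

/-- A longer right end is a shorter one multiplied on the left, which is left coherence for the
reversed product. Behaviour just before T thus also reduces to behaviour at 0. -/
theorem rightEnd_coherentUpTo (x : LeftSection M) {T : PosTime} {f : ∀ r, E r}
    (hf : ∀ ⦃s r : PosTime⦄ (h : s + r = T), x.vec T = M.mul h (x.vec s) (f r)) {T' : PosTime}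
    (hT : T' < T) : M.op.CoherentUpTo T' f := by
  intro r d s h hs
  obtain ⟨q, hq⟩ := PosTime.exists_add_eq (hs.trans_lt hT)
  have hq' : q + s = T := (add_comm q s).trans hq
  have hd : d + r = s := (add_comm d r).trans h
  have hqd : q + d + r = T := by rw [add_assoc, hd, hq']
  obtain ⟨z, hz⟩ := x.coherent (rfl : q + d = q + d)
  refine ⟨z, M.mul_left_cancel hq' (x.ne_zero q) ?_⟩
  rw [← hf hq', op_mul M h hd, ← M.mul_assoc rfl hqd hd hq', ← hz]
  exact hf hqd

/-- With cos² the normalized squared inner product, this is cos²_s ≤ c cos²_t without division; cos²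
is multiplicative over products. -/
theorem inner_sq_le_of_mul (x y : LeftSection M) {s d t : PosTime} (h : s + d = t) {v w : E d}
    (hv : x.vec t = M.mul h (x.vec s) v) (hw : y.vec t = M.mul h (y.vec s) w) {c : ℝ}
    (hvw : (‖v‖ * ‖w‖) ^ 2 ≤ c * ‖inner ℂ w v‖ ^ 2) :
    (‖x.vec t‖ * ‖y.vec t‖) ^ 2 * ‖inner ℂ (y.vec s) (x.vec s)‖ ^ 2 ≤
      c * ‖inner ℂ (y.vec t) (x.vec t)‖ ^ 2 * (‖x.vec s‖ * ‖y.vec s‖) ^ 2 := by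
  rw [hv, hw, M.inner_mul_mul, M.norm_mul, M.norm_mul, _root_.norm_mul]
  calc _ = (‖v‖ * ‖w‖) ^ 2 *
      ((‖x.vec s‖ * ‖y.vec s‖) ^ 2 * ‖inner ℂ (y.vec s) (x.vec s)‖ ^ 2) := by ring
    _ ≤ (c * ‖inner ℂ w v‖ ^ 2) *
      ((‖x.vec s‖ * ‖y.vec s‖) ^ 2 * ‖inner ℂ (y.vec s) (x.vec s)‖ ^ 2) := by gcongr
    _ = _ := by ring

theorem inner_ne_zero_of_sq_le (x y : LeftSection M) {s t : PosTime} {c : ℝ}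
    (hs : inner ℂ (y.vec s) (x.vec s) ≠ 0)
    (h : (‖x.vec t‖ * ‖y.vec t‖) ^ 2 * ‖inner ℂ (y.vec s) (x.vec s)‖ ^ 2 ≤
        c * ‖inner ℂ (y.vec t) (x.vec t)‖ ^ 2 * (‖x.vec s‖ * ‖y.vec s‖) ^ 2) :
    inner ℂ (y.vec t) (x.vec t) ≠ 0 := by
  intro h0
  rw [h0] at h
  have h1 := norm_pos_iff.2 (x.ne_zero t)
  have h2 := norm_pos_iff.2 (y.ne_zero t)
  have h3 := norm_pos_iff.2 hs
  have : 0 < (‖x.vec t‖ * ‖y.vec t‖) ^ 2 * ‖inner ℂ (y.vec s) (x.vec s)‖ ^ 2 := by positivity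
  rw [norm_zero] at h
  linarith

/-! ### The kernel: nonvanishing, growth and continuity. -/

open Classical in
/-- The kernel `⟨x_t|y_t⟩ / (⟨x_t|e_t⟩ ⟨e_t|y_t⟩)`, extended by `1` to `t ≤ 0`. -/
noncomputable def ratio (e x y : LeftSection M) (t : ℝ) : ℂ :=
  if h : 0 < t then inner ℂ (y.vec ⟨t, h⟩) (x.vec ⟨t, h⟩) /
    (inner ℂ (e.vec ⟨t, h⟩) (x.vec ⟨t, h⟩) * inner ℂ (y.vec ⟨t, h⟩) (e.vec ⟨t, h⟩)) else 1

theorem ratio_of_pos (e x y : LeftSection M) {t : ℝ} (h : 0 < t) :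
    ratio e x y t = inner ℂ (y.vec ⟨t, h⟩) (x.vec ⟨t, h⟩) /
    (inner ℂ (e.vec ⟨t, h⟩) (x.vec ⟨t, h⟩) * inner ℂ (y.vec ⟨t, h⟩) (e.vec ⟨t, h⟩)) := dif_pos h

theorem ratio_of_nonpos (e x y : LeftSection M) {t : ℝ} (h : t ≤ 0) : ratio e x y t = 1 :=
  dif_neg h.not_gt

theorem conj_ratio (e x y : LeftSection M) (t : ℝ) :
    (starRingEnd ℂ) (ratio e x y t) = ratio e y x t := by
  rcases le_or_gt t 0 with h | h
  · rw [ratio_of_nonpos e x y h, ratio_of_nonpos e y x h, map_one]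
  · rw [ratio_of_pos e x y h, ratio_of_pos e y x h, map_div₀, map_mul, inner_conj_symm,
      inner_conj_symm, inner_conj_symm, mul_comm]

/-- The diagonal of the kernel, as a real number. -/
noncomputable def diag (e x : LeftSection M) (t : ℝ) : ℝ := (ratio e x x t).re

theorem ratio_self (e x : LeftSection M) (t : ℝ) : ratio e x x t = (diag e x t : ℂ) :=
  (Complex.conj_eq_iff_re.1 (conj_ratio e x x t)).symm

theorem diag_of_pos (e x : LeftSection M) {t : ℝ} (h : 0 < t) :
    diag e x t = ‖x.vec ⟨t, h⟩‖ ^ 2 / ‖inner ℂ (e.vec ⟨t, h⟩) (x.vec ⟨t, h⟩)‖ ^ 2 := by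
  rw [diag, ratio_of_pos e x x h, ← inner_conj_symm (x.vec ⟨t, h⟩) (e.vec ⟨t, h⟩),
    Complex.mul_conj, Complex.normSq_eq_norm_sq, inner_self_eq_norm_sq_to_K]
  simp only [Complex.coe_algebraMap]
  rw [← Complex.ofReal_pow, ← Complex.ofReal_div, Complex.ofReal_re]

theorem norm_ratio_sq_le (e x y : LeftSection M)
    (t : ℝ) : ‖ratio e x y t‖ ^ 2 ≤ diag e x t * diag e y t := by
  rcases le_or_gt t 0 with ht | ht
  · simp [diag, ratio_of_nonpos _ _ _ ht]
  · rw [ratio_of_pos _ _ _ ht, diag_of_pos _ _ ht, diag_of_pos _ _ ht, norm_div,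
      _root_.norm_mul, norm_inner_symm (y.vec _) (e.vec _), div_pow, mul_pow, div_mul_div_comm]
    gcongr
    rw [← mul_pow, mul_comm]
    gcongr
    exact norm_inner_le_norm _ _

variable [∀ t, CompleteSpace (E t)] [∀ t, TopologicalSpace.SeparableSpace (E t)]

theorem exists_sq_le_zero (x y : LeftSection M) {c : ℝ} (hc : 1 < c) : ∃ r : PosTime, ∀ t ≤ r,
    (‖x.vec t‖ * ‖y.vec t‖) ^ 2 ≤ c * ‖inner ℂ (y.vec t) (x.vec t)‖ ^ 2 := by
  obtain ⟨r, -, hr⟩ := exists_forall_norm_mul_norm_sq_le (x.coherentUpTo ⟨1, one_pos⟩)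
    (y.coherentUpTo _) (fun t _ => x.ne_zero t) (fun t _ => y.ne_zero t) hc
  exact ⟨r, hr⟩

theorem exists_sq_le_right (x y : LeftSection M) (s : PosTime) {c : ℝ} (hc : 1 < c) :
    ∃ r : PosTime, ∀ d ≤ r, ∀ t, s + d = t →
      (‖x.vec t‖ * ‖y.vec t‖) ^ 2 * ‖inner ℂ (y.vec s) (x.vec s)‖ ^ 2 ≤
        c * ‖inner ℂ (y.vec t) (x.vec t)‖ ^ 2 * (‖x.vec s‖ * ‖y.vec s‖) ^ 2 := by
  obtain ⟨x', hx'⟩ := x.exists_tail s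
  obtain ⟨y', hy'⟩ := y.exists_tail s
  obtain ⟨r, hr⟩ := exists_sq_le_zero x' y' hc
  exact ⟨r, fun d hd t h => inner_sq_le_of_mul x y h (hx' h) (hy' h) (hr d hd)⟩

theorem exists_sq_le_left (x y : LeftSection M) (t : PosTime) {c : ℝ} (hc : 1 < c) :
    ∃ r : PosTime, ∀ d ≤ r, ∀ s, s + d = t →
      (‖x.vec t‖ * ‖y.vec t‖) ^ 2 * ‖inner ℂ (y.vec s) (x.vec s)‖ ^ 2 ≤
        c * ‖inner ℂ (y.vec t) (x.vec t)‖ ^ 2 * (‖x.vec s‖ * ‖y.vec s‖) ^ 2 := by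
  obtain ⟨f, hf⟩ := x.exists_rightEnd t
  obtain ⟨g, hg⟩ := y.exists_rightEnd t
  have hT : (⟨t / 2, half_pos t.2⟩ : PosTime) < t := half_lt_self t.2
  obtain ⟨r, -, hr⟩ := exists_forall_norm_mul_norm_sq_le (x.rightEnd_coherentUpTo hf hT)
    (y.rightEnd_coherentUpTo hg hT) (fun _ h => x.rightEnd_ne_zero hf (h.trans_lt hT))
    (fun _ h => y.rightEnd_ne_zero hg (h.trans_lt hT)) hc
  exact ⟨r, fun d hd s h => inner_sq_le_of_mul x y h (hf h) (hg h) (hr d hd)⟩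

/-- Coherent families are nowhere orthogonal. -/
theorem inner_vec_ne_zero (x y : LeftSection M) (t : PosTime) :
    inner ℂ (y.vec t) (x.vec t) ≠ 0 := by
  have anti : ∀ s t : PosTime, s ≤ t → inner ℂ (y.vec t) (x.vec t) ≠ 0 →
      inner ℂ (y.vec s) (x.vec s) ≠ 0 := by
    intro s t hst ht h0
    rcases hst.eq_or_lt with rfl | hlt
    · exact ht h0
    · obtain ⟨d, hd⟩ := PosTime.exists_add_eq hlt
      obtain ⟨v, hv⟩ := x.coherent hd
      obtain ⟨w, hw⟩ := y.coherent hd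
      rw [hv, hw, M.inner_mul_mul, h0, zero_mul] at ht
      exact ht rfl
  intro ht
  -- By `anti`, A is an initial interval, bounded by t if the claim fails. The comparison from the
  -- left puts sup A into A, and the one from the right then exceeds it.
  set A : Set ℝ := {a | ∃ h : 0 < a, inner ℂ (y.vec ⟨a, h⟩) (x.vec ⟨a, h⟩) ≠ 0} with hA
  have hbdd : BddAbove A := by
    refine ⟨t, ?_⟩
    rintro a ⟨ha, hane⟩
    by_contra! hlt
    exact anti t ⟨a, ha⟩ hlt.le hane ht
  obtain ⟨r, hr⟩ := exists_sq_le_zero x y one_lt_two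
  have hrA : (r : ℝ) ∈ A := by
    refine ⟨r.2, fun h0 => ?_⟩
    have h1 := hr r le_rfl
    have h2 := norm_pos_iff.2 (x.ne_zero r)
    have h3 := norm_pos_iff.2 (y.ne_zero r)
    have h4 : inner ℂ (y.vec r) (x.vec r) = 0 := h0
    rw [h4] at h1
    have : 0 < (‖x.vec r‖ * ‖y.vec r‖) ^ 2 := by positivity
    rw [norm_zero] at h1
    linarith
  have hσ : 0 < sSup A := r.2.trans_le (le_csSup hbdd hrA)
  set σ : PosTime := ⟨sSup A, hσ⟩ with hσdef
  have hσne : inner ℂ (y.vec σ) (x.vec σ) ≠ 0 := by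
    obtain ⟨ρ, hρ⟩ := exists_sq_le_left x y σ one_lt_two
    obtain ⟨a, ⟨ha, hane⟩, hlt⟩ := exists_lt_of_lt_csSup ⟨_, hrA⟩ (sub_lt_self (sSup A) ρ.2)
    have hle : a ≤ sSup A := le_csSup hbdd ⟨ha, hane⟩
    rcases hle.eq_or_lt with heq | hlt'
    · have : (⟨a, ha⟩ : PosTime) = σ := Subtype.ext heq
      rwa [this] at hane
    · obtain ⟨d, hd⟩ := PosTime.exists_add_eq (show (⟨a, ha⟩ : PosTime) < σ from hlt')
      have hdρ : d ≤ ρ := by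
        have h1 : a + d = sSup A := congrArg Subtype.val hd
        exact Subtype.coe_le_coe.1 (by linarith)
      exact inner_ne_zero_of_sq_le x y hane (hρ d hdρ _ hd)
  obtain ⟨ρ, hρ⟩ := exists_sq_le_right x y σ one_lt_two
  have h1 := inner_ne_zero_of_sq_le x y hσne (hρ ρ le_rfl _ rfl)
  have h2 : ((σ + ρ : PosTime) : ℝ) ≤ sSup A := le_csSup hbdd ⟨(σ + ρ).2, h1⟩
  exact absurd (PosTime.left_lt_add σ ρ) (not_lt.2 h2)

theorem ratio_ne_zero (e x y : LeftSection M) (t : ℝ) : ratio e x y t ≠ 0 := by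
  rcases le_or_gt t 0 with h | h
  · rw [ratio_of_nonpos e x y h]; exact one_ne_zero
  · rw [ratio_of_pos e x y h]
    exact div_ne_zero (inner_vec_ne_zero _ _ _)
      (_root_.mul_ne_zero (inner_vec_ne_zero _ _ _) (inner_vec_ne_zero _ _ _))

/-- The kernel grows by factors `1 + ⟨a_x|a_y⟩`. -/
theorem exists_ratio_eq (e : LeftSection M) (he : ∀ t, ‖e.vec t‖ = 1) {s t : ℝ} (hst : s ≤ t) :
    ∃ (d : PosTime) (a : LeftSection M → E d), ∀ x y,
      ratio e x y t = ratio e x y s * (1 + inner ℂ (a y) (a x)) := by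
  rcases hst.eq_or_lt with rfl | hst
  · exact ⟨⟨1, one_pos⟩, 0, by simp⟩
  rcases le_or_gt t 0 with ht | ht
  · refine ⟨⟨1, one_pos⟩, 0, fun x y => ?_⟩
    rw [ratio_of_nonpos _ _ _ ht, ratio_of_nonpos _ _ _ (hst.le.trans ht)]
    simp
  rcases le_or_gt s 0 with hs | hs
  · refine ⟨⟨t, ht⟩, fun x => (inner ℂ (e.vec ⟨t, ht⟩) (x.vec ⟨t, ht⟩))⁻¹ • x.vec ⟨t, ht⟩ -
      e.vec ⟨t, ht⟩, fun x y => ?_⟩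
    rw [ratio_of_nonpos _ _ _ hs, one_mul, ratio_of_pos _ _ _ ht]
    exact (one_add_inner_sub (he _) (inner_vec_ne_zero _ _ _) (inner_vec_ne_zero _ _ _)).symm
  · obtain ⟨d, hd⟩ := PosTime.exists_add_eq (show (⟨s, hs⟩ : PosTime) < ⟨t, ht⟩ from hst)
    choose τ hτ using fun x : LeftSection M => x.exists_tail ⟨s, hs⟩
    have hτe : ‖(τ e).vec d‖ = 1 := by
      have h1 := congrArg norm (hτ e hd)
      rw [M.norm_mul, he, he, one_mul] at h1
      exact h1.symm
    -- Scaled to have inner product 1 with the unit tail of e, each tail is that tail plus an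
    -- orthogonal vector, which is a_x.
    refine ⟨d, fun x => (inner ℂ ((τ e).vec d) ((τ x).vec d))⁻¹ • (τ x).vec d - (τ e).vec d,
      fun x y => ?_⟩
    rw [one_add_inner_sub hτe (inner_vec_ne_zero _ _ _) (inner_vec_ne_zero _ _ _),
      ratio_of_pos _ _ _ hs, ratio_of_pos _ _ _ ht, hτ x hd, hτ y hd, hτ e hd,
      M.inner_mul_mul, M.inner_mul_mul, M.inner_mul_mul]
    have := inner_vec_ne_zero x e ⟨s, hs⟩
    have := inner_vec_ne_zero e y ⟨s, hs⟩
    have := inner_vec_ne_zero (τ x) (τ e) d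
    have := inner_vec_ne_zero (τ e) (τ y) d
    field_simp

theorem exists_diag_eq (e : LeftSection M) (he : ∀ t, ‖e.vec t‖ = 1) {s t : ℝ} (hst : s ≤ t) :
    ∃ (d : PosTime) (a : LeftSection M → E d), (∀ x y,
      ratio e x y t = ratio e x y s * (1 + inner ℂ (a y) (a x))) ∧
      ∀ x, diag e x t = diag e x s * (1 + ‖a x‖ ^ 2) := by
  obtain ⟨d, a, ha⟩ := exists_ratio_eq e he hst
  refine ⟨d, a, ha, fun x => ?_⟩
  have h1 := ha x x
  rw [ratio_self, ratio_self, inner_self_eq_norm_sq_to_K] at h1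
  simp only [Complex.coe_algebraMap] at h1
  exact_mod_cast h1

theorem diag_pos (e : LeftSection M) (he : ∀ t, ‖e.vec t‖ = 1) (x : LeftSection M) (t : ℝ) :
    0 < diag e x t := by
  obtain ⟨d, a, -, ha⟩ := exists_diag_eq e he (min_le_left t 0)
  rw [ha, diag, ratio_of_nonpos _ _ _ (min_le_right t 0), Complex.one_re]
  positivity

theorem diag_mono (e : LeftSection M) (he : ∀ t, ‖e.vec t‖ = 1) (x : LeftSection M) :
    Monotone (diag e x) := by
  intro s t hst
  obtain ⟨d, a, -, ha⟩ := exists_diag_eq e he hst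
  rw [ha]
  have := diag_pos e he x s
  nlinarith [sq_nonneg ‖a x‖]

/-- For unit e, `diag` is 1/cos² of the angle between x and e. -/
theorem diag_le_mul (e : LeftSection M) (he : ∀ t, ‖e.vec t‖ = 1) (x : LeftSection M) {s t : ℝ}
    (hs : 0 < s) (ht : 0 < t) {c : ℝ}
    (h : (‖x.vec ⟨t, ht⟩‖ * ‖e.vec ⟨t, ht⟩‖) ^ 2 *
        ‖inner ℂ (e.vec ⟨s, hs⟩) (x.vec ⟨s, hs⟩)‖ ^ 2 ≤
      c * ‖inner ℂ (e.vec ⟨t, ht⟩) (x.vec ⟨t, ht⟩)‖ ^ 2 *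
        (‖x.vec ⟨s, hs⟩‖ * ‖e.vec ⟨s, hs⟩‖) ^ 2) :
    diag e x t ≤ c * diag e x s := by
  rw [he, he, mul_one, mul_one] at h
  rw [diag_of_pos e x hs, diag_of_pos e x ht, ← mul_div_assoc]
  have h1 := norm_pos_iff.2 (inner_vec_ne_zero x e ⟨s, hs⟩)
  have h2 := norm_pos_iff.2 (inner_vec_ne_zero x e ⟨t, ht⟩)
  rw [div_le_div_iff₀ (by positivity) (by positivity)]
  linarith

theorem exists_diag_right_le (e : LeftSection M) (he : ∀ t, ‖e.vec t‖ = 1) (x : LeftSection M)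
    (s : ℝ) {c : ℝ} (hc : 1 < c) : ∃ t > s, diag e x t ≤ c * diag e x s := by
  rcases lt_trichotomy s 0 with hs | rfl | hs
  · refine ⟨0, hs, ?_⟩
    rw [diag, diag, ratio_of_nonpos _ _ _ le_rfl, ratio_of_nonpos _ _ _ hs.le, Complex.one_re]
    linarith
  · obtain ⟨r, hr⟩ := exists_sq_le_zero x e hc
    refine ⟨r, r.2, ?_⟩
    have h1 := hr r le_rfl
    rw [he, mul_one] at h1
    rw [diag_of_pos e x r.2, diag, ratio_of_nonpos _ _ _ le_rfl, Complex.one_re, mul_one]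
    exact div_le_of_le_mul₀ (by positivity) (by linarith) h1
  · obtain ⟨r, hr⟩ := exists_sq_le_right x e ⟨s, hs⟩ hc
    exact ⟨s + r, lt_add_of_pos_right s r.2,
      diag_le_mul e he x hs (add_pos hs r.2) (hr r le_rfl _ rfl)⟩

theorem exists_diag_left_le (e : LeftSection M) (he : ∀ t, ‖e.vec t‖ = 1) (x : LeftSection M)
    (t : ℝ) {c : ℝ} (hc : 1 < c) : ∃ s < t, diag e x t ≤ c * diag e x s := by
  rcases le_or_gt t 0 with ht | ht
  · refine ⟨t - 1, by linarith, ?_⟩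
    rw [diag, diag, ratio_of_nonpos _ _ _ ht, ratio_of_nonpos _ _ _ (by linarith), Complex.one_re]
    linarith
  · obtain ⟨r, hr⟩ := exists_sq_le_left x e ⟨t, ht⟩ hc
    have hd : 0 < min (r : ℝ) (t / 2) := lt_min r.2 (half_pos ht)
    have hs : 0 < t - min (r : ℝ) (t / 2) := by linarith [min_le_right (r : ℝ) (t / 2)]
    exact ⟨t - min (r : ℝ) (t / 2), by linarith,
      diag_le_mul e he x hs ht (hr ⟨_, hd⟩ (Subtype.coe_le_coe.1 (min_le_left (r : ℝ) _)) ⟨_, hs⟩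
        (Subtype.ext (sub_add_cancel _ _)))⟩

/-- By monotonicity, one point on each side with ratio at most c, for c arbitrarily close to 1,
excludes jumps. -/
theorem continuous_diag (e : LeftSection M) (he : ∀ t, ‖e.vec t‖ = 1) (x : LeftSection M) :
    Continuous (diag e x) := by
  rw [continuous_iff_continuousAt]
  intro t
  have hp := diag_pos e he x t
  have hm := diag_mono e he x
  refine tendsto_order.2 ⟨fun a ha => ?_, fun b hb => ?_⟩
  · rcases le_or_gt a 0 with h0 | h0
    · exact Eventually.of_forall fun s => h0.trans_lt (diag_pos e he x s)
    obtain ⟨c, hc1, hc2⟩ := exists_between ((one_lt_div h0).2 ha)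
    obtain ⟨s, hs, hle⟩ := exists_diag_left_le e he x t hc1
    filter_upwards [Ioi_mem_nhds hs] with r hr
    rw [lt_div_iff₀ h0] at hc2
    exact lt_of_lt_of_le (lt_of_mul_lt_mul_left (hc2.trans_le hle) (by linarith)) (hm hr.le)
  · obtain ⟨c, hc1, hc2⟩ := exists_between ((one_lt_div hp).2 hb)
    obtain ⟨s, hs, hle⟩ := exists_diag_right_le e he x t hc1
    filter_upwards [Iio_mem_nhds hs] with r hr
    rw [lt_div_iff₀ hp] at hc2
    exact (hm hr.le).trans_lt (hle.trans_lt hc2)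

/-- Cauchy–Schwarz for both factors of the increment k_s(x, y)⟨a_x|a_y⟩; it transfers continuity
from the diagonal to the whole kernel. -/
theorem norm_ratio_sub_sq_le (e : LeftSection M) (he : ∀ t, ‖e.vec t‖ = 1) (x y : LeftSection M)
    (s t : ℝ) : ‖ratio e x y t - ratio e x y s‖ ^ 2 ≤
      (diag e x t - diag e x s) * (diag e y t - diag e y s) := by
  wlog hst : s ≤ t generalizing s t
  · rw [norm_sub_rev]
    exact (this t s (le_of_not_ge hst)).trans_eq (by ring)
  obtain ⟨d, a, ha, hd⟩ := exists_diag_eq e he hst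
  rw [ha, hd, hd]
  calc ‖ratio e x y s * (1 + inner ℂ (a y) (a x)) - ratio e x y s‖ ^ 2
      = ‖ratio e x y s‖ ^ 2 * ‖inner ℂ (a y) (a x)‖ ^ 2 := by
        rw [← mul_pow, ← _root_.norm_mul]; congr 2; ring
    _ ≤ (diag e x s * diag e y s) * (‖a y‖ * ‖a x‖) ^ 2 := by
        refine mul_le_mul (norm_ratio_sq_le e x y s) ?_ (sq_nonneg _) ?_
        · gcongr
          exact norm_inner_le_norm _ _
        · exact (mul_pos (diag_pos e he x s) (diag_pos e he y s)).le
    _ = _ := by ring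

theorem continuous_ratio (e : LeftSection M) (he : ∀ t, ‖e.vec t‖ = 1) (x y : LeftSection M) :
    Continuous (ratio e x y) := by
  rw [continuous_iff_continuousAt]
  intro s
  have h1 : Tendsto (fun t => (diag e x t - diag e x s) * (diag e y t - diag e y s)) (𝓝 s)
      (𝓝 0) := by
    have := (((continuous_diag e he x).sub continuous_const).mul
      ((continuous_diag e he y).sub continuous_const)).tendsto
        (f := fun t => (diag e x t - diag e x s) * (diag e y t - diag e y s)) s
    simpa using this
  have h2 := squeeze_zero (fun t => sq_nonneg _) (fun t => norm_ratio_sub_sq_le e he x y s t) h1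
  have h3 := h2.sqrt
  simp only [Real.sqrt_sq (norm_nonneg _), Real.sqrt_zero] at h3
  exact tendsto_iff_norm_sub_tendsto_zero.2 h3

end LeftSection

end TensorFamily

/-! ### Continuous logarithms and logarithms of small kernels. -/

theorem exists_continuous_log {g : ℝ → ℂ} (hg : Continuous g) (h0 : ∀ t, g t ≠ 0)
    (h1 : g 0 = 1) : ∃ l : ℝ → ℂ, Continuous l ∧ l 0 = 0 ∧ ∀ t, Complex.exp (l t) = g t := by
  obtain ⟨F, ⟨hF0, hF⟩, -⟩ := Complex.isCoveringMapOn_exp.existsUnique_continuousMap_lifts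
    ⟨g, hg⟩ (a₀ := 0) (e₀ := 0) (by simp [h1]) h0
  exact ⟨F, F.continuous, hF0, fun t => congrFun hF t⟩

theorem eqOn_of_exp_eqOn {X : Type*} [TopologicalSpace X] {S : Set X} (hS : IsPreconnected S)
    {f g : X → ℂ} (hf : ContinuousOn f S) (hg : ContinuousOn g S)
    (h : ∀ x ∈ S, Complex.exp (f x) = Complex.exp (g x)) {a : X} (ha : a ∈ S)
    (hfg : f a = g a) : S.EqOn f g :=
  Complex.isCoveringMap_exp.eqOn_of_comp_eqOn hS hf hg (fun x hx => Subtype.ext (h x hx)) ha hfg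

section LogKernel

variable {ι F : Type*} [NormedAddCommGroup F] [InnerProductSpace ℂ F]

theorem sum_conj_mul_inner_nonneg (S : Finset ι) (c : ι → ℂ) (a : ι → F) :
    0 ≤ (∑ i ∈ S, ∑ j ∈ S, (starRingEnd ℂ) (c i) * inner ℂ (a j) (a i) * c j).re := by
  have : ∑ i ∈ S, ∑ j ∈ S, (starRingEnd ℂ) (c i) * inner ℂ (a j) (a i) * c j =
      inner ℂ (∑ j ∈ S, (starRingEnd ℂ) (c j) • a j) (∑ i ∈ S, (starRingEnd ℂ) (c i) • a i) := by
    simp only [sum_inner, inner_sum, inner_smul_left, inner_smul_right, Complex.conj_conj, Finset.mul_sum]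
    exact Finset.sum_congr rfl fun _ _ => Finset.sum_congr rfl fun _ _ => by ring
  rw [this]
  exact inner_self_nonneg (𝕜 := ℂ)

theorem norm_log_one_add_sub_self_le_sq {z : ℂ} (hz : ‖z‖ ≤ 1 / 2) :
    ‖Complex.log (1 + z) - z‖ ≤ ‖z‖ ^ 2 := by
  refine (Complex.norm_log_one_add_sub_self_le (by linarith)).trans ?_
  have : (1 - ‖z‖)⁻¹ ≤ 2 := by rw [inv_le_comm₀ (by linarith) two_pos]; linarith
  nlinarith [sq_nonneg ‖z‖]

/-- The logarithm of a small kernel `1 + ⟨a_i|a_j⟩` is almost positive definite. -/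
theorem sum_log_one_add_inner_nonneg (S : Finset ι) (c : ι → ℂ) (a : ι → F) {δ η : ℝ}
    (hη : η ≤ 1 / 2) (hδ : 2 * (η * (∑ i ∈ S, ‖c i‖) ^ 2) ≤ δ) (ha : ∀ i ∈ S, ‖a i‖ ^ 2 ≤ η) :
    0 ≤ (∑ i ∈ S, ∑ j ∈ S,
        (starRingEnd ℂ) (c i) * Complex.log (1 + inner ℂ (a j) (a i)) * c j).re +
      δ * ∑ i ∈ S, (Complex.log (1 + inner ℂ (a i) (a i))).re := by
  rcases S.eq_empty_or_nonempty with rfl | ⟨i₀, hi₀⟩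
  · simp
  have hη0 : 0 ≤ η := (sq_nonneg _).trans (ha i₀ hi₀)
  -- The quadratic error of log(1 + z) is thus η times a diagonal quantity, which the δ term can
  -- absorb.
  have hb : ∀ i ∈ S, ∀ j ∈ S, ‖inner ℂ (a j) (a i)‖ ^ 2 ≤ ‖a i‖ ^ 2 * η := by
    intro i _ j hj
    calc ‖inner ℂ (a j) (a i)‖ ^ 2 ≤ (‖a j‖ * ‖a i‖) ^ 2 := by
          gcongr; exact norm_inner_le_norm _ _
      _ = ‖a i‖ ^ 2 * ‖a j‖ ^ 2 := by ring
      _ ≤ _ := by gcongr; exact ha j hj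
  have hb2 : ∀ i ∈ S, ∀ j ∈ S, ‖inner ℂ (a j) (a i)‖ ≤ 1 / 2 := by
    intro i hi j hj
    have h1 := hb i hi j hj
    have h2 : ‖a i‖ ^ 2 * η ≤ (1 / 2) ^ 2 := by nlinarith [ha i hi, sq_nonneg ‖a i‖]
    exact (sq_le_sq₀ (norm_nonneg _) (by norm_num)).1 (h1.trans h2)
  have hl : ∀ i ∈ S, ∀ j ∈ S,
      ‖Complex.log (1 + inner ℂ (a j) (a i)) - inner ℂ (a j) (a i)‖ ≤ ‖a i‖ ^ 2 * η :=
    fun i hi j hj => (norm_log_one_add_sub_self_le_sq (hb2 i hi j hj)).trans (hb i hi j hj)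
  set K := ∑ i ∈ S, ‖c i‖ with hK
  have hK0 : 0 ≤ K := Finset.sum_nonneg fun _ _ => norm_nonneg _
  set A := ∑ i ∈ S, ‖a i‖ ^ 2 with hA
  have hA0 : 0 ≤ A := Finset.sum_nonneg fun _ _ => sq_nonneg _
  -- Each term is at least (1 - η)‖a_i‖², and η ≤ 1/2.
  have hdiag : A / 2 ≤ ∑ i ∈ S, (Complex.log (1 + inner ℂ (a i) (a i))).re := by
    rw [hA, Finset.sum_div]
    refine Finset.sum_le_sum fun i hi => ?_
    have h1 := (Complex.abs_re_le_norm _).trans (hl i hi i hi)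
    rw [Complex.sub_re, inner_self_eq_norm_sq_to_K] at h1
    have h2 : (((‖a i‖ : ℝ) : ℂ) ^ 2).re = ‖a i‖ ^ 2 := by
      rw [← Complex.ofReal_pow, Complex.ofReal_re]
    simp only [Complex.coe_algebraMap] at h1
    rw [h2] at h1
    rw [inner_self_eq_norm_sq_to_K]
    simp only [Complex.coe_algebraMap]
    have h3 := (abs_le.1 h1).1
    nlinarith [sq_nonneg ‖a i‖]
  have hoff : -(K ^ 2 * (A * η)) ≤ (∑ i ∈ S, ∑ j ∈ S, (starRingEnd ℂ) (c i) *
      (Complex.log (1 + inner ℂ (a j) (a i)) - inner ℂ (a j) (a i)) * c j).re := by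
    refine (abs_le.1 ((Complex.abs_re_le_norm _).trans ?_)).1
    calc _ ≤ ∑ i ∈ S, ∑ j ∈ S, ‖c i‖ * (A * η) * ‖c j‖ := by
          refine (norm_sum_le _ _).trans (Finset.sum_le_sum fun i hi => ?_)
          refine (norm_sum_le _ _).trans (Finset.sum_le_sum fun j hj => ?_)
          rw [norm_mul, norm_mul, RCLike.norm_conj]
          gcongr
          refine (hl i hi j hj).trans ?_
          gcongr
          exact Finset.single_le_sum (f := fun i => ‖a i‖ ^ 2) (fun _ _ => sq_nonneg _) hi
      _ = K ^ 2 * (A * η) := by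
          simp only [← Finset.mul_sum, ← Finset.sum_mul, ← hK]
          ring
  have hsum : ∑ i ∈ S, ∑ j ∈ S,
        (starRingEnd ℂ) (c i) * Complex.log (1 + inner ℂ (a j) (a i)) * c j =
      (∑ i ∈ S, ∑ j ∈ S, (starRingEnd ℂ) (c i) * inner ℂ (a j) (a i) * c j) +
      ∑ i ∈ S, ∑ j ∈ S, (starRingEnd ℂ) (c i) *
        (Complex.log (1 + inner ℂ (a j) (a i)) - inner ℂ (a j) (a i)) * c j := by
    rw [← Finset.sum_add_distrib]
    refine Finset.sum_congr rfl fun _ _ => ?_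
    rw [← Finset.sum_add_distrib]
    exact Finset.sum_congr rfl fun _ _ => by ring
  rw [hsum, Complex.add_re]
  have h1 := sum_conj_mul_inner_nonneg S c a
  have hδ0 : 0 ≤ δ := le_trans (by positivity) hδ
  have h2 : δ * (A / 2) ≤ δ * ∑ i ∈ S, (Complex.log (1 + inner ℂ (a i) (a i))).re := by gcongr
  have h3 : 2 * (η * K ^ 2) * A ≤ δ * A := by gcongr
  nlinarith

end LogKernel

/-! ### Positive definiteness of the logarithm. -/

namespace TensorFamily

variable {E : PosTime → Type u} [∀ t, NormedAddCommGroup (E t)] [∀ t, InnerProductSpace ℂ (E t)]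
  [∀ t, CompleteSpace (E t)] [∀ t, TopologicalSpace.SeparableSpace (E t)] {M : TensorFamily E}

namespace LeftSection

theorem exists_logRatio (e : LeftSection M) (he : ∀ t, ‖e.vec t‖ = 1) (x y : LeftSection M) :
    ∃ l : ℝ → ℂ, Continuous l ∧ l 0 = 0 ∧ ∀ t, Complex.exp (l t) = ratio e x y t :=
  exists_continuous_log (continuous_ratio e he x y) (ratio_ne_zero e x y)
    (ratio_of_nonpos e x y le_rfl)

/-- The continuous logarithm of the kernel, vanishing at `0`. -/
noncomputable def logRatio (e : LeftSection M) (he : ∀ t, ‖e.vec t‖ = 1) (x y : LeftSection M) :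
    ℝ → ℂ := (exists_logRatio e he x y).choose

variable (e : LeftSection M) (he : ∀ t, ‖e.vec t‖ = 1)

theorem continuous_logRatio (x y : LeftSection M) : Continuous (logRatio e he x y) :=
  (exists_logRatio e he x y).choose_spec.1

theorem logRatio_zero (x y : LeftSection M) : logRatio e he x y 0 = 0 :=
  (exists_logRatio e he x y).choose_spec.2.1

theorem exp_logRatio (x y : LeftSection M) (t : ℝ) :
    Complex.exp (logRatio e he x y t) = ratio e x y t :=
  (exists_logRatio e he x y).choose_spec.2.2 t

/-- Continuation from 0 to t sees the kernel on [0, t] only, so what the sections do after t is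
irrelevant. -/
theorem logRatio_congr {x y x' y' : LeftSection M} {t : ℝ} (ht : 0 ≤ t)
    (h : ∀ s ∈ Set.Icc 0 t, ratio e x y s = ratio e x' y' s) :
    logRatio e he x y t = logRatio e he x' y' t :=
  eqOn_of_exp_eqOn isPreconnected_Icc (continuous_logRatio e he x y).continuousOn
    (continuous_logRatio e he x' y').continuousOn
    (fun s hs => by rw [exp_logRatio, exp_logRatio, h s hs]) (Set.left_mem_Icc.2 ht)
    (by rw [logRatio_zero, logRatio_zero]) (Set.right_mem_Icc.2 ht)

theorem conj_logRatio (x y : LeftSection M) (t : ℝ) :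
    (starRingEnd ℂ) (logRatio e he x y t) = logRatio e he y x t :=
  eqOn_of_exp_eqOn isPreconnected_univ
    (Complex.continuous_conj.comp (continuous_logRatio e he x y)).continuousOn
    (continuous_logRatio e he y x).continuousOn
    (fun s _ => by
      rw [Function.comp_apply, Complex.exp_conj, exp_logRatio, exp_logRatio, conj_ratio])
    (Set.mem_univ (0 : ℝ)) (by simp [logRatio_zero]) (Set.mem_univ t)

theorem eventually_le_sum_logRatio (S : Finset (LeftSection M)) (c : LeftSection M → ℂ) {δ : ℝ}
    (hδ : 0 < δ) (s : ℝ) : ∀ᶠ t in 𝓝[>] s,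
      (∑ i ∈ S, ∑ j ∈ S, (starRingEnd ℂ) (c i) * logRatio e he i j s * c j).re +
        δ * ∑ i ∈ S, (logRatio e he i i s).re ≤
      (∑ i ∈ S, ∑ j ∈ S, (starRingEnd ℂ) (c i) * logRatio e he i j t * c j).re +
        δ * ∑ i ∈ S, (logRatio e he i i t).re := by
  set K := ∑ i ∈ S, ‖c i‖
  have hK : 0 ≤ K := Finset.sum_nonneg fun _ _ => norm_nonneg _
  -- These are the two smallness conditions of `sum_log_one_add_inner_nonneg`; the added 1 covers K
  -- = 0.
  set η : ℝ := min (1 / 2) (δ / (2 * (K ^ 2 + 1)))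
  have hη0 : 0 < η := by positivity
  have hηδ : 2 * (η * K ^ 2) ≤ δ := by
    have h1 : η ≤ δ / (2 * (K ^ 2 + 1)) := min_le_right _ _
    rw [le_div_iff₀ (by positivity)] at h1
    nlinarith
  have h1 : ∀ᶠ t in 𝓝[>] s, ∀ i ∈ S, ∀ j ∈ S,
      ‖logRatio e he i j t - logRatio e he i j s‖ < 1 := by
    rw [Filter.eventually_all_finset]
    intro i _
    rw [Filter.eventually_all_finset]
    intro j _
    have := (continuous_logRatio e he i j).tendsto s
    have h2 := Metric.tendsto_nhds.1 this 1 one_pos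
    simp only [dist_eq_norm] at h2
    exact h2.filter_mono nhdsWithin_le_nhds
  have h2 : ∀ᶠ t in 𝓝[>] s, ∀ i ∈ S, diag e i t ≤ diag e i s * (1 + η) := by
    rw [Filter.eventually_all_finset]
    intro i _
    have hp := diag_pos e he i s
    exact (((continuous_diag e he i).tendsto s).eventually_le_const
      (by nlinarith)).filter_mono nhdsWithin_le_nhds
  filter_upwards [h1, h2, self_mem_nhdsWithin] with t ht1 ht2 hst
  obtain ⟨d, a, ha, hd⟩ := exists_diag_eq e he (le_of_lt hst)
  -- Increments of norm below 1 < π stay in the principal branch.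
  have hlog : ∀ i ∈ S, ∀ j ∈ S, logRatio e he i j t =
      logRatio e he i j s + Complex.log (1 + inner ℂ (a j) (a i)) := by
    intro i hi j hj
    have h3 : 1 + inner ℂ (a j) (a i) =
        Complex.exp (logRatio e he i j t - logRatio e he i j s) := by
      rw [Complex.exp_sub, exp_logRatio, exp_logRatio, ha,
        mul_div_cancel_left₀ _ (ratio_ne_zero e i j s)]
    have h4 := abs_le.1 ((Complex.abs_im_le_norm _).trans (ht1 i hi j hj).le)
    rw [h3, Complex.log_exp (by linarith [Real.pi_gt_three]) (by linarith [Real.pi_gt_three])]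
    ring
  have hsmall : ∀ i ∈ S, ‖a i‖ ^ 2 ≤ η := by
    intro i hi
    have h3 := ht2 i hi
    rw [hd] at h3
    linarith [le_of_mul_le_mul_left h3 (diag_pos e he i s)]
  have key := sum_log_one_add_inner_nonneg S c a (min_le_left _ _) hηδ hsmall
  have e1 : ∑ i ∈ S, ∑ j ∈ S, (starRingEnd ℂ) (c i) * logRatio e he i j t * c j =
      ∑ i ∈ S, ∑ j ∈ S, (starRingEnd ℂ) (c i) * logRatio e he i j s * c j +
      ∑ i ∈ S, ∑ j ∈ S,
        (starRingEnd ℂ) (c i) * Complex.log (1 + inner ℂ (a j) (a i)) * c j := by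
    rw [← Finset.sum_add_distrib]
    refine Finset.sum_congr rfl fun i hi => ?_
    rw [← Finset.sum_add_distrib]
    exact Finset.sum_congr rfl fun j hj => by rw [hlog i hi j hj]; ring
  have e2 : ∑ i ∈ S, (logRatio e he i i t).re = ∑ i ∈ S, (logRatio e he i i s).re +
      ∑ i ∈ S, (Complex.log (1 + inner ℂ (a i) (a i))).re := by
    rw [← Finset.sum_add_distrib]
    exact Finset.sum_congr rfl fun i hi => by rw [hlog i hi i hi, Complex.add_re]
  rw [e1, e2, Complex.add_re]
  linarith

/-- The logarithm of the kernel is positive definite. -/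
theorem sum_logRatio_nonneg (S : Finset (LeftSection M)) (c : LeftSection M → ℂ) {t : ℝ}
    (ht : 0 ≤ t) :
    0 ≤ ∑ i ∈ S, ∑ j ∈ S, (starRingEnd ℂ) (c i) * logRatio e he i j t * c j := by
  have him : (∑ i ∈ S, ∑ j ∈ S, (starRingEnd ℂ) (c i) * logRatio e he i j t * c j).im = 0 := by
    rw [← Complex.conj_eq_iff_im, map_sum, Finset.sum_comm]
    refine Finset.sum_congr rfl fun i _ => ?_
    rw [map_sum]
    refine Finset.sum_congr rfl fun j _ => ?_
    rw [map_mul, map_mul, Complex.conj_conj, conj_logRatio]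
    ring
  have hre : ∀ δ > 0, 0 ≤ (∑ i ∈ S, ∑ j ∈ S,
      (starRingEnd ℂ) (c i) * logRatio e he i j t * c j).re +
        δ * ∑ i ∈ S, (logRatio e he i i t).re := by
    intro δ hδ
    set w : ℝ → ℝ := fun t => (∑ i ∈ S, ∑ j ∈ S,
      (starRingEnd ℂ) (c i) * logRatio e he i j t * c j).re +
        δ * ∑ i ∈ S, (logRatio e he i i t).re with hw
    have hwc : Continuous w := by
      have := continuous_logRatio e he
      have h1 : Continuous fun t => ∑ i ∈ S, ∑ j ∈ S,
          (starRingEnd ℂ) (c i) * logRatio e he i j t * c j := by fun_prop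
      have h2 : Continuous fun t => ∑ i ∈ S, (logRatio e he i i t).re :=
        continuous_finsetSum _ fun i _ => Complex.continuous_re.comp (this i i)
      exact (Complex.continuous_re.comp h1).add (continuous_const.mul h2)
    -- Continuous induction: w vanishes at 0 and does not drop below w(s) immediately after s.
    have hsub : Set.Icc 0 t ⊆ {s | 0 ≤ w s} := by
      refine IsClosed.Icc_subset_of_forall_mem_nhdsWithin
        ((isClosed_le continuous_const hwc).inter isClosed_Icc) ?_ fun s hs => ?_
      · simp [hw, logRatio_zero]
      · filter_upwards [eventually_le_sum_logRatio e he S c hδ s] with r hr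
        exact le_trans hs.1 hr
    exact hsub (Set.right_mem_Icc.2 ht)
  rw [Complex.nonneg_iff]
  refine ⟨?_, him.symm⟩
  have hlim : Tendsto (fun δ : ℝ => (∑ i ∈ S, ∑ j ∈ S,
      (starRingEnd ℂ) (c i) * logRatio e he i j t * c j).re +
        δ * ∑ i ∈ S, (logRatio e he i i t).re) (𝓝[>] 0) (𝓝 ((∑ i ∈ S, ∑ j ∈ S,
      (starRingEnd ℂ) (c i) * logRatio e he i j t * c j).re +
        0 * ∑ i ∈ S, (logRatio e he i i t).re)) :=
    ((continuous_const.add (continuous_id.mul continuous_const)).tendsto _).mono_left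
      nhdsWithin_le_nhds
  rw [zero_mul, add_zero] at hlim
  exact ge_of_tendsto hlim (by filter_upwards [self_mem_nhdsWithin] with δ hδ using hre δ hδ)

end LeftSection

end TensorFamily

/-! ### Decomposable vectors as values of coherent sections. -/

namespace TensorFamily

variable {E : PosTime → Type u} [∀ t, NormedAddCommGroup (E t)] [∀ t, InnerProductSpace ℂ (E t)]
  {M : TensorFamily E}

/-- A decomposable vector at time `t` extends, given some coherent section `e`, to a coherent
section: it is factored before `t` and multiplied by `e` after `t`. -/
theorem LeftSection.exists_vec_eq [∀ t, CompleteSpace (E t)] (e : LeftSection M) {t : PosTime}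
    {x : E t} (hx : x ≠ 0)
    (hdec : ∀ s d (h : s + d = t), ∃ (y : E s) (z : E d), x = M.mul h y z) :
    ∃ X : LeftSection M, X.vec t = x := by
  -- Times d are strictly positive, so s = t needs its own clause. Left factors before t are chosen
  -- independently of each other.
  have hex : ∀ s : PosTime, ∃ v : E s, (∀ d (h : s + d = t), ∃ z : E d, x = M.mul h v z) ∧
      (s = t → HEq v x) ∧ ∀ d (h : t + d = s), v = M.mul h x (e.vec d) := by
    intro s
    rcases lt_trichotomy s t with hst | rfl | hst
    · obtain ⟨d, hd⟩ := PosTime.exists_add_eq hst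
      obtain ⟨y, z, hyz⟩ := hdec s d hd
      refine ⟨y, fun d' h' => ?_, fun h => absurd h hst.ne, fun d' h' =>
        absurd (PosTime.left_lt h') hst.not_gt⟩
      obtain rfl : d = d' := add_left_cancel (hd.trans h'.symm)
      exact ⟨z, hyz⟩
    · exact ⟨x, fun d h => absurd (PosTime.left_lt h) (lt_irrefl _), fun _ => HEq.rfl,
        fun d h => absurd (PosTime.left_lt h) (lt_irrefl _)⟩
    · obtain ⟨d, hd⟩ := PosTime.exists_add_eq hst
      refine ⟨M.mul hd x (e.vec d), fun d' h' => absurd (PosTime.left_lt h') hst.not_gt,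
        fun h => absurd h hst.ne', fun d' h' => ?_⟩
      obtain rfl : d = d' := add_left_cancel (hd.trans h'.symm)
      rfl
  choose v hlt heq hgt using hex
  have hvt : v t = x := eq_of_heq (heq t rfl)
  refine ⟨⟨v, fun s => ?_, fun r d s h => ?_⟩, hvt⟩
  · rcases lt_trichotomy s t with hst | rfl | hst
    · obtain ⟨d, hd⟩ := PosTime.exists_add_eq hst
      obtain ⟨z, hz⟩ := hlt s d hd
      exact M.left_ne_zero (hz ▸ hx)
    · rwa [hvt]
    · obtain ⟨d, hd⟩ := PosTime.exists_add_eq hst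
      rw [hgt s d hd]
      exact M.mul_ne_zero hd hx (e.ne_zero d)
  · rcases lt_trichotomy s t with hst | rfl | hst
    · obtain ⟨c, hc⟩ := PosTime.exists_add_eq hst
      obtain ⟨z, hz⟩ := hlt s c hc
      have hdc : r + (d + c) = t := by rw [← add_assoc, h, hc]
      obtain ⟨w, hw⟩ := hlt r (d + c) hdc
      -- Two independently chosen left factors of x are automatically coherent: the shorter divides
      -- the longer.
      exact M.exists_eq_mul_of_mul_eq hc hdc h (hz.symm.trans hw)
        (M.right_ne_zero (hz ▸ hx))
    · rw [hvt]
      exact hlt r d h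
    · obtain ⟨c, hc⟩ := PosTime.exists_add_eq hst
      rw [hgt s c hc]
      rcases lt_trichotomy r t with hrt | rfl | hrt
      · obtain ⟨b, hb⟩ := PosTime.exists_add_eq hrt
        obtain ⟨z, hz⟩ := hlt r b hb
        have hbc : b + c = d := by
          apply add_left_cancel (a := r)
          rw [← add_assoc, hb, hc, h]
        exact ⟨M.mul hbc z (e.vec c), by
          conv_lhs => rw [hz]
          exact M.mul_assoc _ _ _ _ _ _ _⟩
      · obtain rfl : c = d := add_left_cancel (hc.trans h.symm)
        exact ⟨e.vec c, by rw [hvt]⟩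
      · obtain ⟨b, hb⟩ := PosTime.exists_add_eq hrt
        have hbd : b + d = c := by
          apply add_left_cancel (a := t)
          rw [← add_assoc, hb, hc, h]
        obtain ⟨z, hz⟩ := e.coherent hbd
        exact ⟨z, by rw [hgt r b hb, hz]; exact (M.mul_assoc _ _ _ _ _ _ _).symm⟩

/-- Left factors are unique up to scalars, so the class at t fixes all earlier classes. -/
theorem LeftSection.exists_smul_of_le (x x' : LeftSection M) {s t : PosTime} (hst : s ≤ t) {c : ℂ}
    (h : x.vec t = c • x'.vec t) : ∃ c' : ℂ, c' ≠ 0 ∧ x.vec s = c' • x'.vec s := by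
  rcases hst.eq_or_lt with rfl | hlt
  · refine ⟨c, ?_, h⟩
    rintro rfl
    exact x.ne_zero s (by rw [h, zero_smul])
  · obtain ⟨d, hd⟩ := PosTime.exists_add_eq hlt
    obtain ⟨z, hz⟩ := x.coherent hd
    obtain ⟨z', hz'⟩ := x'.coherent hd
    refine M.exists_smul_of_mul_eq hd (y := z) (y' := c • z') ?_ (hz ▸ x.ne_zero t)
    rw [← hz, h, hz', map_smul]

theorem LeftSection.ratio_congr (e : LeftSection M) {x x' y y' : LeftSection M} {t : PosTime}
    {c c' : ℂ} (hx : x.vec t = c • x'.vec t) (hy : y.vec t = c' • y'.vec t) {s : ℝ} (hs : s ≤ t) :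
    ratio e x y s = ratio e x' y' s := by
  rcases le_or_gt s 0 with h0 | h0
  · rw [ratio_of_nonpos _ _ _ h0, ratio_of_nonpos _ _ _ h0]
  · obtain ⟨a, ha, hxa⟩ := x.exists_smul_of_le x' (s := ⟨s, h0⟩) hs hx
    obtain ⟨b, hb, hyb⟩ := y.exists_smul_of_le y' (s := ⟨s, h0⟩) hs hy
    have hb' : (starRingEnd ℂ) b ≠ 0 := (map_ne_zero _).2 hb
    rw [ratio_of_pos _ _ _ h0, ratio_of_pos _ _ _ h0, hxa, hyb]
    simp only [inner_smul_left, inner_smul_right]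
    rw [← mul_div_mul_left (inner ℂ (y'.vec _) (x'.vec _)) _ (_root_.mul_ne_zero ha hb')]
    congr 1 <;> ring

end TensorFamily

theorem TotalSpace.mk_injective {E : PosTime → Type u} {t : PosTime} {x y : E t}
    (h : TotalSpace.mk (E := E) t x = TotalSpace.mk t y) : x = y := by
  simpa using h

/-! ### The e-logarithm of a product system. -/

namespace ProductSystem

variable {E : PosTime → Type u} [∀ t, NormedAddCommGroup (E t)]
  [∀ t, InnerProductSpace ℂ (E t)] [∀ t, CompleteSpace (E t)]
  [∀ t, TopologicalSpace.SeparableSpace (E t)] [MeasurableSpace (TotalSpace E)]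
  (P : ProductSystem E)

/-- The multiplication of a product system, with values in `E u` for any `u = s + t`. -/
def mulOfEq {s t u : PosTime} (h : s + t = u) : E s →ₗ[ℂ] E t →ₗ[ℂ] E u := h ▸ P.mul

theorem mulOfEq_rfl {s t : PosTime} : P.mulOfEq (rfl : s + t = s + t) = P.mul := rfl

theorem mk_mulOfEq {s t u : PosTime} (h : s + t = u) (x : E s) (y : E t) :
    TotalSpace.mk (E := E) u (P.mulOfEq h x y) = TotalSpace.mk (s + t) (P.mul x y) := by
  subst h; rfl

/-- The algebraic part of a product system. -/
def toTensorFamily : TensorFamily E where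
  mul := P.mulOfEq
  inner_mul_mul h := by subst h; exact P.inner_mul_mul
  dense_span_mul {s t u} h := by subst h; exact P.dense_span_mul s t
  mul_assoc h₁ h₂ h₃ h₄ x y z := by
    apply TotalSpace.mk_injective
    subst h₁ h₃
    rw [mk_mulOfEq, mk_mulOfEq, mulOfEq_rfl, mulOfEq_rfl]
    exact P.mul_assoc x y z

variable {P}

theorem exists_mul_eq_of_mem_D {t : PosTime} {x : E t} (hx : x ∈ P.D t) (s d : PosTime)
    (h : s + d = t) : ∃ (y : E s) (z : E d), x = P.toTensorFamily.mul h y z := by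
  obtain ⟨y, z, hyz⟩ := hx.2 s d h
  exact ⟨y, z, TotalSpace.mk_injective (hyz.symm.trans (P.mk_mulOfEq h y z).symm)⟩

/-- A coherent section as a section of the underlying tensor family. -/
def CoherentSection.toLeft (x : P.CoherentSection) : P.toTensorFamily.LeftSection where
  vec := x.vec
  ne_zero t := (x.mem_D t).1
  coherent r d s h := by subst h; exact x.coherent r d

theorem vec_mem_D (x : P.toTensorFamily.LeftSection) (t : PosTime) : x.vec t ∈ P.D t := by
  refine ⟨x.ne_zero t, fun s d h => ?_⟩
  obtain ⟨z, hz⟩ := x.coherent h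
  exact ⟨x.vec s, z, by rw [hz]; exact (P.mk_mulOfEq h _ _).symm⟩

/-- A section of the underlying tensor family as a coherent section. -/
def ofLeft (x : P.toTensorFamily.LeftSection) : P.CoherentSection where
  vec := x.vec
  mem_D := vec_mem_D x
  coherent _ _ := x.coherent rfl

theorem exists_section (e : P.CoherentSection) {t : PosTime} (x : P.D t) :
    ∃ X : P.toTensorFamily.LeftSection, X.vec t = x :=
  e.toLeft.exists_vec_eq x.2.1 (exists_mul_eq_of_mem_D x.2)

variable (e : P.CoherentSection) (he : ∀ t, ‖e.toLeft.vec t‖ = 1)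

/-- A coherent section through a decomposable vector. -/
noncomputable def sectionThrough {t : PosTime} (x : P.D t) : P.toTensorFamily.LeftSection :=
  (exists_section e x).choose

theorem sectionThrough_vec {t : PosTime} (x : P.D t) : (sectionThrough e x).vec t = x :=
  (exists_section e x).choose_spec

theorem cls_ofLeft_sectionThrough {t : PosTime} (x : P.D t) :
    (ofLeft (sectionThrough e x)).cls t = P.cls x :=
  congrArg P.cls (Subtype.ext (sectionThrough_vec e x))

/-- The `e`-logarithm. -/
noncomputable def eLog (t : PosTime) (a b : P.Δ t) : ℂ :=
  TensorFamily.LeftSection.logRatio e.toLeft he (sectionThrough e (Quotient.out a))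
    (sectionThrough e (Quotient.out b)) t

/-- The choices of representative and section are immaterial: up to time t the sections differ by
scalars, which cancel in the kernel. -/
theorem eLog_cls (x y : P.toTensorFamily.LeftSection) (t : PosTime) :
    eLog e he t ((ofLeft x).cls t) ((ofLeft y).cls t) =
      TensorFamily.LeftSection.logRatio e.toLeft he x y t := by
  have hout : ∀ x : P.toTensorFamily.LeftSection, ∃ c : ℂ,
      (sectionThrough e (Quotient.out ((ofLeft x).cls t))).vec t = c • x.vec t := by
    intro x
    obtain ⟨c, -, hc⟩ := Quotient.exact (Quotient.out_eq ((ofLeft x).cls t))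
    exact ⟨c, by rw [sectionThrough_vec]; exact hc⟩
  obtain ⟨c, hc⟩ := hout x
  obtain ⟨c', hc'⟩ := hout y
  exact TensorFamily.LeftSection.logRatio_congr _ _ t.2.le fun s hs =>
    TensorFamily.LeftSection.ratio_congr _ hc hc' hs.2

theorem eLog_cls_D {t : PosTime} (x y : P.D t) : eLog e he t (P.cls x) (P.cls y) =
    TensorFamily.LeftSection.logRatio e.toLeft he (sectionThrough e x) (sectionThrough e y) t := by
  rw [← eLog_cls, cls_ofLeft_sectionThrough, cls_ofLeft_sectionThrough]

theorem isELogarithm_eLog : P.IsELogarithm e (eLog e he) where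
  continuous x y := by
    simp only [show x.cls = (ofLeft x.toLeft).cls from rfl,
      show y.cls = (ofLeft y.toLeft).cls from rfl, eLog_cls]
    exact (TensorFamily.LeftSection.continuous_logRatio _ _ _ _).comp continuous_subtype_val
  vanishes x y := by
    simp only [show x.cls = (ofLeft x.toLeft).cls from rfl,
      show y.cls = (ofLeft y.toLeft).cls from rfl, eLog_cls]
    have h := (TensorFamily.LeftSection.continuous_logRatio e.toLeft he x.toLeft y.toLeft).tendsto 0
    rw [TensorFamily.LeftSection.logRatio_zero] at h
    exact (h.mono_left nhdsWithin_le_nhds).comp tendsto_comap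
  exp_eq t x y := by
    rw [eLog_cls_D, TensorFamily.LeftSection.exp_logRatio,
      TensorFamily.LeftSection.ratio_of_pos _ _ _ t.2]
    simp only [sectionThrough_vec]
    rfl

theorem IsELogarithm.eq {e : P.CoherentSection} {L L' : ∀ t : PosTime, P.Δ t → P.Δ t → ℂ}
    (hL : P.IsELogarithm e L) (hL' : P.IsELogarithm e L') : L' = L := by
  funext t a b
  obtain ⟨x, rfl⟩ := Quotient.exists_rep a
  obtain ⟨y, rfl⟩ := Quotient.exists_rep b
  change L' t (P.cls x) (P.cls y) = L t (P.cls x) (P.cls y)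
  rw [← cls_ofLeft_sectionThrough e x, ← cls_ofLeft_sectionThrough e y]
  set X := ofLeft (sectionThrough e x)
  set Y := ofLeft (sectionThrough e y)
  have hexp : ∀ s, Complex.exp (L' s (X.cls s) (Y.cls s)) =
      Complex.exp (L s (X.cls s) (Y.cls s)) := fun s => by
    rw [CoherentSection.cls, CoherentSection.cls, hL.exp_eq, hL'.exp_eq]
  -- The difference of the two logarithms takes values in 2πiℤ and tends to 0, so it vanishes at
  -- some time s; connectedness of (0, ∞) carries this to t.
  have hne : (comap (fun t : PosTime => (t : ℝ)) (𝓝[>] 0)).NeBot :=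
    comap_coe_neBot_of_le_principal (s := Set.Ioi (0 : ℝ)) inf_le_right
  have hlim := (hL'.vanishes X Y).sub (hL.vanishes X Y)
  rw [sub_zero] at hlim
  obtain ⟨s, hs⟩ := (Metric.tendsto_nhds.1 hlim 1 one_pos).exists
  rw [dist_zero_right] at hs
  have hs0 : L' s (X.cls s) (Y.cls s) = L s (X.cls s) (Y.cls s) := by
    have h1 := abs_le.1 ((Complex.abs_im_le_norm _).trans hs.le)
    have h2 := Complex.log_exp (by linarith [Real.pi_gt_three]) (h1.2.trans (by
      linarith [Real.pi_gt_three]))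
    rw [Complex.exp_sub, hexp, div_self (Complex.exp_ne_zero _), Complex.log_one] at h2
    exact sub_eq_zero.1 h2.symm
  have : PreconnectedSpace PosTime := Subtype.preconnectedSpace isPreconnected_Ioi
  exact eqOn_of_exp_eqOn isPreconnected_univ (hL'.continuous X Y).continuousOn
    (hL.continuous X Y).continuousOn (fun s _ => hexp s) (Set.mem_univ s) hs0 (Set.mem_univ t)

theorem posSemidef_eLog (t : PosTime) :
    (Matrix.of fun x y : P.D t => eLog e he t (P.cls x) (P.cls y)).PosSemidef := by
  refine ⟨Matrix.IsHermitian.ext fun x y => ?_, fun c => ?_⟩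
  · rw [Matrix.of_apply, Matrix.of_apply, eLog_cls_D, eLog_cls_D]
    exact TensorFamily.LeftSection.conj_logRatio _ _ _ _ _
  -- The finite sum over vectors is reindexed by sections, each carrying the coefficient of its
  -- value at t.
  · have hinj : Function.Injective fun x : P.D t => sectionThrough e x := fun x y h =>
      Subtype.ext (by
        rw [← sectionThrough_vec e x, ← sectionThrough_vec e y]
        exact congrArg (fun X => X.vec t) h)
    have h := TensorFamily.LeftSection.sum_logRatio_nonneg e.toLeft he
      (c.support.map ⟨_, hinj⟩) (fun X => c ⟨X.vec t, vec_mem_D X t⟩) t.2.le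
    simp only [Finset.sum_map, Function.Embedding.coeFn_mk, sectionThrough_vec,
      Subtype.coe_eta] at h
    simpa only [Finsupp.sum, Matrix.of_apply, eLog_cls_D, starRingEnd_apply] using h

end ProductSystem

theorem mainTheorem5 {E : PosTime → Type u} [∀ t, NormedAddCommGroup (E t)]
    [∀ t, InnerProductSpace ℂ (E t)] [∀ t, CompleteSpace (E t)]
    [∀ t, TopologicalSpace.SeparableSpace (E t)] [MeasurableSpace (TotalSpace E)]
    (P : ProductSystem E) (e : P.CoherentSection) (he : ∀ t : PosTime, ‖e.vec t‖ = 1) :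
    ∃ L : ∀ t : PosTime, P.Δ t → P.Δ t → ℂ,
      P.IsELogarithm e L ∧
      (∀ L' : ∀ t : PosTime, P.Δ t → P.Δ t → ℂ, P.IsELogarithm e L' → L' = L) ∧
      ∀ t : PosTime,
        (Matrix.of fun x y : P.D t => L t (P.cls x) (P.cls y)).PosSemidef :=
  ⟨ProductSystem.eLog e he, ProductSystem.isELogarithm_eLog e he,
    fun _ h => (ProductSystem.isELogarithm_eLog e he).eq h, ProductSystem.posSemidef_eLog e he⟩
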